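/- Let $(a_n)_{n\ge1}$ be a sequence of positive real numbers that is regularly varying with index $\alpha>0$, i.e. $a_{\lfloor cn\rfloor}/a_n\to c^{\alpha}$ as $n\to\infty$ for every $c>0$. For $n\ge 1$ let $\mathsf b_n$ be a closed segment of length $a_n$. Let $T_1=\mathsf b_1$, rooted at one of its two extremities, and recursively, for $n\ge1$, let $T_{n+1}$ be obtained by gluing one extremity of $\mathsf b_{n+1}$ to a random point of $T_n$ which, given $T_n$, is uniform on $T_n$ (i.e. distributed according to the normalized length measure). Let $d$ denote the length metric of these trees. Let $D_n=d(X_n,\mathrm{root})$, where, given $T_n$, the point $X_n$ is uniform on $T_n$, and let $H_n=\max_{v\in T_n}d(v,\mathrm{root})$. For $\lambda\in\mathbb R$ set $$\phi_{(\alpha)}(\lambda)=\frac{\alpha+1}{\alpha}\int_0^1\big(e^{\lambda u}-1\big)\frac{1-u}{u}\,du .$$ There is exactly one probability distribution on $\mathbb R$ such that a random variable $\xi_{(\alpha)}$ with this distribution satisfies $\mathbb E[e^{\lambda\xi_{(\alpha)}}]=e^{\phi_{(\alpha)}(\lambda)}$ for all $\lambda\in\mathbb R$. Moreover: (i) $D_n/a_n$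 converges in distribution to $\xi_{(\alpha)}$ as $n\to\infty$. More precisely, $\mathbb E[\exp(\lambda D_n/a_n)]\to\mathbb E[\exp(\lambda\xi_{(\alpha)})]$ for all $\lambda\in\mathbb R$; in particular all positive moments converge: $\mathbb E[(D_n/a_n)^p]\to\mathbb E[\xi_{(\alpha)}^p]<\infty$ for all real $p>0$. (ii) Almost surely, $$\frac{H_n\,\ln\ln n}{a_n\ln n}\longrightarrow 1\qquad\text{as } n\to\infty .$$ -/

import Mathlib

open MeasureTheory ProbabilityTheory Filter Topology

noncomputable section

namespace LineBreaking

/-- Regular variation of the sequence `(a n)`, `n ≥ 1`, with index `α`. -/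
def IsRegularlyVarying (a : ℕ → ℝ) (α : ℝ) : Prop :=
  ∀ c : ℝ, 0 < c → Tendsto (fun n : ℕ => a ⌊c * n⌋₊ / a n) atTop (𝓝 (c ^ α))

/-- The points of `T n`. The segments are `b 1, b 2, …`, where `b i` has length `a i`, and the pair
`(i, s)` with `0 ≤ s ≤ a i` is the point of `b i` at distance `s` from its base, the extremity by
which `b i` is glued to the earlier segments. The base `(i, 0)`, `i ≥ 2`, is the same point of the
tree as the point to which it is glued: it has distance `0` to it for `treeDist` below. -/
def treePoints (a : ℕ → ℝ) (n : ℕ) : Set (ℕ × ℝ) :=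
  {x | x.1 ∈ Set.Icc 1 n ∧ x.2 ∈ Set.Icc 0 (a x.1)}

/-- The root, an extremity of `b 1`. -/
def root : ℕ × ℝ := (1, 0)

/-- The length metric of `T n` (as a pseudometric on `treePoints a n`), when for each `k ≥ 1` the
segment `b (k + 1)` is glued by its base to the point `g k` of `T k`. Two points of the new segment
are at their distance in the segment; a path between the new segment and the older tree passes
through the gluing point; distances in the older tree do not change. The tree `T 0` is empty, so
that the value at stage `0` plays no role. -/
def treeDist (g : ℕ → ℕ × ℝ) : ℕ → ℕ × ℝ → ℕ × ℝ → ℝ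
  | 0, _, _ => 0
  | n + 1, x, y =>
    if x.1 = n + 1 then
      if y.1 = n + 1 then |x.2 - y.2| else x.2 + treeDist g n (g n) y
    else
      if y.1 = n + 1 then treeDist g n x (g n) + y.2 else treeDist g n x y

/-- The uniform probability measure on `T n`: the length measure (Lebesgue measure on each of the
segments `b 1, …, b n`), divided by the total length. -/
def uniformMeasure (a : ℕ → ℝ) (n : ℕ) : Measure (ℕ × ℝ) :=
  (ENNReal.ofReal (∑ i ∈ Finset.Icc 1 n, a i))⁻¹ •
    ∑ i ∈ Finset.Icc 1 n, (volume.restrict (Set.Icc 0 (a i))).map (Prod.mk i)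

/-- `Z` is a uniform random point of `T n` given `T n`, where `T n` is the tree built with the
random gluing points `Y 1, …, Y (n - 1)`: whatever these are, the conditional law of the coordinates
of `Z` is the normalized length measure. -/
def IsUniformPoint {Ω : Type*} [MeasurableSpace Ω] (P : Measure Ω) (a : ℕ → ℝ)
    (Y : ℕ → Ω → ℕ × ℝ) (n : ℕ) (Z : Ω → ℕ × ℝ) : Prop :=
  Measurable Z ∧ P.map Z = uniformMeasure a n ∧
    IndepFun Z (fun ω (k : Finset.Ico 1 n) => Y k ω) P

/-- `Y` is a sequence of gluing points of the `(a n)`-model: for each `n ≥ 1`, the point `Y n`, to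
which `b (n + 1)` is glued, is uniform on `T n` given `T n`. -/
def IsGluingSequence {Ω : Type*} [MeasurableSpace Ω] (P : Measure Ω) (a : ℕ → ℝ)
    (Y : ℕ → Ω → ℕ × ℝ) : Prop :=
  ∀ n : ℕ, 1 ≤ n → IsUniformPoint P a Y n (Y n)

/-- The height `D n = d(X n, root)` in `T n` of the point `X n`. -/
def pointHeight {Ω : Type*} (Y X : ℕ → Ω → ℕ × ℝ) (n : ℕ) (ω : Ω) : ℝ :=
  treeDist (fun k => Y k ω) n (X n ω) root

/-- The height `H n` of the tree `T n`. -/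
def treeHeight {Ω : Type*} (a : ℕ → ℝ) (Y : ℕ → Ω → ℕ × ℝ) (n : ℕ) (ω : Ω) : ℝ :=
  sSup ((fun v => treeDist (fun k => Y k ω) n v root) '' treePoints a n)

/-- The exponent `φ_(α)`. -/
def phi (α lam : ℝ) : ℝ :=
  (α + 1) / α * ∫ u in (0 : ℝ)..1, (Real.exp (lam * u) - 1) * ((1 - u) / u)

/-- `ν` is the law of `ξ_(α)`: its Laplace transform is `exp φ_(α)` on the whole of `ℝ`. -/
def IsXiLaw (α : ℝ) (ν : Measure ℝ) : Prop :=
  ∀ lam : ℝ, Integrable (fun x => Real.exp (lam * x)) ν ∧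
    ∫ x, Real.exp (lam * x) ∂ν = Real.exp (phi α lam)

end LineBreaking

end

/-!
Split the height `D n` according to whether the uniform point of `T n` lies on the last segment,
which has probability `a n / A n`, where `A n` is the length of `T n`. Since the base of that
segment is glued to a uniform point of `T (n - 1)`, the Laplace transform of `D n` is a product,
`E[exp (θ * D n)] = ∏ i ≤ n, (1 + (a i / A i) * ∫ (exp (θ * a i * u) - 1) du)`. At `θ = λ / a n`
only the indices `i` of order `n` matter, the other ones being dominated by Potter bounds, and the
sum of the exponents converges to `φ_(α) (λ)` by Karamata's theorem.

The same product, with `λ` of order `ln ln n`, makes `P (D n ≥ (1 + ε) a n ln n / ln ln n)`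
summable, and the base of every segment is a uniform point, whence the upper bound for `H n`. For
the lower bound, cut the last `δ n` indices into about `(1 - η) ln n / ln ln n` blocks and look for
chains of segments, one in each block, each of which is glued close to the tip of the preceding one.
The number of chains is multiplied at every block by a factor of order `ln ln n / ln n` at worst,
except on an event that Chernoff's inequality controls, so that a power of `n` of them survives.
-/

namespace LineBreaking

/-! ### Potter bounds for regularly varying sequences -/

/-- Potter bounds of index `ρ` for a sequence `(c n)`, `n ≥ 1`, of positive reals, in logarithmic
form: the uniform version of regular variation with index `ρ`. -/
structure PotterBounds (c : ℕ → ℝ) (ρ : ℝ) : Prop where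
  pos : ∀ n : ℕ, 1 ≤ n → 0 < c n
  eventually_abs_le : ∀ ε : ℝ, 0 < ε → ∀ᶠ n : ℕ in atTop, ∀ m : ℕ, n ≤ m →
    |Real.log (c m) - Real.log (c n) - ρ * Real.log (m / n)| ≤ ε * (1 + Real.log (m / n))

lemma log_div_nonneg_of_le {n m : ℕ} (hn : 1 ≤ n) (hnm : n ≤ m) :
    0 ≤ Real.log ((m : ℝ) / n) :=
  Real.log_nonneg ((one_le_div (by exact_mod_cast hn)).2 (by exact_mod_cast hnm))

section PotterTheorem

variable {a : ℕ → ℝ} {α : ℝ}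

lemma IsRegularlyVarying.tendsto_log_sub_log (ha : ∀ n : ℕ, 1 ≤ n → 0 < a n)
    (hreg : IsRegularlyVarying a α) {c : ℝ} (hc : 0 < c) :
    Tendsto (fun n : ℕ => Real.log (a ⌊c * n⌋₊) - Real.log (a n)) atTop
      (𝓝 (α * Real.log c)) := by
  have hlog := (hreg c hc).log (Real.rpow_pos_of_pos hc α).ne'
  rw [Real.log_rpow hc] at hlog
  refine hlog.congr' ?_
  have hfloor : ∀ᶠ n : ℕ in atTop, 1 ≤ c * n :=
    (tendsto_natCast_atTop_atTop.const_mul_atTop hc).eventually_ge_atTop 1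
  filter_upwards [hfloor, eventually_ge_atTop 1] with n hcn hn
  rw [Real.log_div (ha _ (Nat.one_le_floor_iff _ |>.2 hcn)).ne' (ha n hn).ne']

/-- Egorov's theorem makes the convergence uniform in the scale `c`, off a small set of scales. -/
lemma IsRegularlyVarying.exists_forall_notMem_abs_le (ha : ∀ n : ℕ, 1 ≤ n → 0 < a n)
    (hreg : IsRegularlyVarying a α) (C : ℝ) {δ ε : ℝ} (hδ : 0 < δ) (hε : 0 < ε) :
    ∃ B : Set ℝ, volume B ≤ ENNReal.ofReal δ ∧
      ∀ᶠ n : ℕ in atTop, ∀ c ∈ Set.Icc 1 C, c ∉ B →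
        |Real.log (a ⌊c * n⌋₊) - Real.log (a n) - α * Real.log c| ≤ ε := by
  have hmeas (n : ℕ) : Measurable fun c : ℝ => Real.log (a ⌊c * n⌋₊) - Real.log (a n) :=
    ((measurable_from_top (f := fun k : ℕ => Real.log (a k))).comp
      (Nat.measurable_floor.comp (measurable_id.mul_const _))).sub_const _
  obtain ⟨B, -, -, hB, hunif⟩ := tendstoUniformlyOn_of_ae_tendsto (μ := volume)
    (s := Set.Icc 1 C) (fun n => (hmeas n).stronglyMeasurable)
    (Real.measurable_log.const_mul α).stronglyMeasurable measurableSet_Icc (by simp)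
    (ae_of_all _ fun c hc => hreg.tendsto_log_sub_log ha (one_pos.trans_le hc.1)) hδ
  refine ⟨B, hB, (Metric.tendstoUniformlyOn_iff.1 hunif ε hε).mono fun n hn c hc hcB => ?_⟩
  rw [← Real.dist_eq, dist_comm]
  exact (hn c ⟨hc, hcB⟩).le

/-- The set of scales `c ≥ 0` with `⌊c * k⌋ = p`. -/
def floorCell (k p : ℕ) : Set ℝ := Set.Ico ((p : ℝ) / k) ((p + 1 : ℝ) / k)

lemma floor_mul_of_mem_floorCell {k p : ℕ} (hk : 1 ≤ k) {c : ℝ} (hc : c ∈ floorCell k p) :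
    ⌊c * k⌋₊ = p := by
  have hk₀ : (0 : ℝ) < k := by exact_mod_cast hk
  have hc₀ : 0 ≤ c := le_trans (by positivity) hc.1
  exact (Nat.floor_eq_iff (by positivity)).2 ⟨(div_le_iff₀ hk₀).1 hc.1, (lt_div_iff₀ hk₀).1 hc.2⟩

lemma abs_log_sub_log_le_of_mem_floorCell {k p : ℕ} (hk : 1 ≤ k) (hp : 1 ≤ p) {c : ℝ}
    (hc : c ∈ floorCell k p) : |Real.log c - Real.log (p / k)| ≤ 1 / p := by
  have : (0 : ℝ) < k := by exact_mod_cast hk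
  have : (0 : ℝ) < p := by exact_mod_cast hp
  have hpk : 0 < (p : ℝ) / k := by positivity
  have hc₀ : 0 < c := hpk.trans_le hc.1
  rw [← Real.log_div hc₀.ne' hpk.ne', abs_of_nonneg (Real.log_nonneg ((one_le_div hpk).2 hc.1))]
  refine (Real.log_le_sub_one_of_pos (by positivity)).trans ?_
  rw [sub_le_iff_le_add, div_le_iff₀ hpk]
  calc c ≤ (p + 1) / k := hc.2.le
    _ = (1 / (p : ℝ) + 1) * (p / k) := by field_simp; ring

lemma floorCell_subset_Icc {k p C : ℕ} (hk : 1 ≤ k) (hkp : k ≤ p) (hp : p + 1 ≤ C * k) :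
    floorCell k p ⊆ Set.Icc 1 (C : ℝ) := by
  have hk₀ : (0 : ℝ) < k := by exact_mod_cast hk
  exact fun c hc => ⟨((one_le_div hk₀).2 (by exact_mod_cast hkp)).trans hc.1,
    hc.2.le.trans ((div_le_iff₀ hk₀).2 (by exact_mod_cast hp))⟩

lemma volume_floorCell (k p : ℕ) : volume (floorCell k p) = ENNReal.ofReal (1 / k) := by
  rw [floorCell, Real.volume_Ico, ← sub_div, add_sub_cancel_left]

lemma disjoint_floorCell_of_lt {k l p : ℕ} (hk : 1 ≤ k) (hkl : k < l) (hkp : k ≤ p) :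
    Disjoint (floorCell k p) (floorCell l p) := by
  refine Set.disjoint_left.2 fun c hc hc' => ?_
  have hk₀ : (1 : ℝ) ≤ k := by exact_mod_cast hk
  have hkl' : (k : ℝ) + 1 ≤ l := by exact_mod_cast hkl
  have hkp' : (k : ℝ) ≤ p := by exact_mod_cast hkp
  have : ((p + 1 : ℝ) / l) ≤ (p : ℝ) / k := by
    rw [div_le_div_iff₀ (by linarith) (by linarith)]
    nlinarith
  linarith [hc.1, hc'.2]

lemma card_div_le_volume_of_floorCell_subset {B : Set ℝ} {n p : ℕ} (hnp : n ≤ p) {K : Finset ℕ}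
    (hK : ∀ k ∈ K, k ∈ Set.Icc 1 n) (hB : ∀ k ∈ K, floorCell k p ⊆ B) :
    ENNReal.ofReal ((K.card : ℝ) / n) ≤ volume B := by
  have hdisj : (K : Set ℕ).PairwiseDisjoint fun k => floorCell k p := by
    intro k hk l hl hne
    rcases hne.lt_or_gt with h | h
    · exact disjoint_floorCell_of_lt (hK k hk).1 h ((hK k hk).2.trans hnp)
    · exact (disjoint_floorCell_of_lt (hK l hl).1 h ((hK l hl).2.trans hnp)).symm
  calc ENNReal.ofReal ((K.card : ℝ) / n)
      = ∑ k ∈ K, ENNReal.ofReal (1 / n) := by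
        rw [Finset.sum_const, ← ENNReal.ofReal_nsmul, nsmul_eq_mul, mul_one_div]
    _ ≤ ∑ k ∈ K, volume (floorCell k p) := by
        refine Finset.sum_le_sum fun k hk => ?_
        rw [volume_floorCell]
        have hk₁ : (0 : ℝ) < k := by exact_mod_cast (hK k hk).1
        have hkn : (k : ℝ) ≤ n := by exact_mod_cast (hK k hk).2
        gcongr
    _ = volume (⋃ k ∈ K, floorCell k p) :=
        (measure_biUnion_finset hdisj fun _ _ => measurableSet_Ico).symm
    _ ≤ volume B := measure_mono (Set.iUnion₂_subset hB)

/-- The cells `floorCell k n` with `n / 2 < k ≤ n` are disjoint and have total length at least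
`1 / 2`, hence more than half of them are not contained in `B`; likewise for `m`. -/
lemma exists_floorCell_not_subset {B : Set ℝ} (hB : volume B < ENNReal.ofReal (1 / 4)) {n m : ℕ}
    (hn : 1 ≤ n) (hnm : n ≤ m) :
    ∃ k : ℕ, n < 2 * k ∧ k ≤ n ∧ ¬ floorCell k n ⊆ B ∧ ¬ floorCell k m ⊆ B := by
  classical
  by_contra! hcon
  let K : ℕ → Finset ℕ := fun p => (Finset.Ioc (n / 2) n).filter fun k => floorCell k p ⊆ B
  have hcard (p : ℕ) (hnp : n ≤ p) : 4 * (K p).card < n := by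
    have hle := card_div_le_volume_of_floorCell_subset (K := K p) hnp
      (fun k hk => by
        have := Finset.mem_Ioc.1 (Finset.mem_filter.1 hk).1
        exact ⟨by omega, this.2⟩)
      fun k hk => (Finset.mem_filter.1 hk).2
    have hlt := (ENNReal.ofReal_lt_ofReal_iff (by norm_num)).1 (hle.trans_lt hB)
    rw [div_lt_div_iff₀ (by exact_mod_cast hn) (by norm_num)] at hlt
    have : (4 : ℝ) * (K p).card < n := by linarith
    exact_mod_cast this
  have hcover : Finset.Ioc (n / 2) n ⊆ K n ∪ K m := by
    intro k hk
    have hk' := Finset.mem_Ioc.1 hk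
    by_cases h : floorCell k n ⊆ B
    · exact Finset.mem_union_left _ (Finset.mem_filter.2 ⟨hk, h⟩)
    · exact Finset.mem_union_right _ (Finset.mem_filter.2 ⟨hk, hcon k (by omega) hk'.2 h⟩)
  have hunion := (Finset.card_le_card hcover).trans (Finset.card_union_le _ _)
  rw [Nat.card_Ioc] at hunion
  have := hcard n le_rfl
  have := hcard m hnm
  omega

lemma abs_log_sub_log_le_of_mem_floorCells {ε c c' : ℝ} {k n m : ℕ} (hk : 1 ≤ k) (hn : 1 ≤ n)
    (hnm : n ≤ m) (hαn : |α| * (1 / n) ≤ ε) (hc : c ∈ floorCell k n) (hc' : c' ∈ floorCell k m)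
    (hac : |Real.log (a ⌊c * k⌋₊) - Real.log (a k) - α * Real.log c| ≤ ε)
    (hac' : |Real.log (a ⌊c' * k⌋₊) - Real.log (a k) - α * Real.log c'| ≤ ε) :
    |Real.log (a m) - Real.log (a n) - α * Real.log (m / n)| ≤ 4 * ε := by
  have hk₀ : (0 : ℝ) < k := by exact_mod_cast hk
  have hn₀ : (0 : ℝ) < n := by exact_mod_cast hn
  have hnm' : (n : ℝ) ≤ m := by exact_mod_cast hnm
  have hm₀ : (0 : ℝ) < m := hn₀.trans_le hnm'
  rw [floor_mul_of_mem_floorCell hk hc] at hac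
  rw [floor_mul_of_mem_floorCell hk hc'] at hac'
  have hround (p : ℕ) (hnp : (n : ℝ) ≤ p) (x : ℝ) (hx : x ∈ floorCell k p) :
      |α * (Real.log x - Real.log (p / k))| ≤ ε := by
    have hp : 1 ≤ p := hn.trans (by exact_mod_cast hnp)
    calc |α * (Real.log x - Real.log (p / k))|
        ≤ |α| * (1 / p) := by
          rw [abs_mul]
          exact mul_le_mul_of_nonneg_left (abs_log_sub_log_le_of_mem_floorCell hk hp hx)
            (abs_nonneg α)
      _ ≤ |α| * (1 / n) := by gcongr
      _ ≤ ε := hαn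
  have hround_n := hround n le_rfl c hc
  have hround_m := hround m hnm' c' hc'
  have hlog : Real.log ((m : ℝ) / n) = Real.log (m / k) - Real.log (n / k) := by
    rw [← Real.log_div (by positivity) (by positivity), div_div_div_cancel_right₀ hk₀.ne']
  rw [hlog]
  rw [abs_le] at *
  constructor <;> linarith

lemma IsRegularlyVarying.eventually_abs_le_of_le_two_mul (ha : ∀ n : ℕ, 1 ≤ n → 0 < a n)
    (hreg : IsRegularlyVarying a α) {ε : ℝ} (hε : 0 < ε) :
    ∀ᶠ n : ℕ in atTop, ∀ m : ℕ, n ≤ m → m ≤ 2 * n →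
      |Real.log (a m) - Real.log (a n) - α * Real.log (m / n)| ≤ ε := by
  obtain ⟨B, hB, hunif⟩ := hreg.exists_forall_notMem_abs_le ha (5 : ℕ)
    (show (0 : ℝ) < 1 / 5 by norm_num) (show 0 < ε / 4 by positivity)
  obtain ⟨N, hN⟩ := eventually_atTop.1 hunif
  have hα : ∀ᶠ n : ℕ in atTop, |α| * (1 / n) ≤ ε / 4 := by
    have := (tendsto_one_div_atTop_nhds_zero_nat (𝕜 := ℝ)).const_mul |α|
    rw [mul_zero] at this
    exact this.eventually_le_const (by positivity)
  filter_upwards [hα, eventually_ge_atTop (2 * N + 2)] with n hαn hn m hnm hm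
  obtain ⟨k, hnk, hkn, hcell, hcell'⟩ := exists_floorCell_not_subset (n := n) (m := m)
    (hB.trans_lt ((ENNReal.ofReal_lt_ofReal_iff (by norm_num)).2 (by norm_num)))
    (by omega) hnm
  obtain ⟨c, hc, hcB⟩ := Set.not_subset.1 hcell
  obtain ⟨c', hc', hcB'⟩ := Set.not_subset.1 hcell'
  have hk : 1 ≤ k := by omega
  have hac := hN k (by omega) c (floorCell_subset_Icc hk hkn (by omega) hc) hcB
  have hac' := hN k (by omega) c' (floorCell_subset_Icc hk (by omega) (by omega) hc') hcB'
  exact (abs_log_sub_log_le_of_mem_floorCells hk (by omega) hnm hαn hc hc' hac hac').trans_eq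
    (by ring)

/-- The dyadic bound is iterated along the halvings of `m`. -/
theorem IsRegularlyVarying.potterBounds (ha : ∀ n : ℕ, 1 ≤ n → 0 < a n)
    (hreg : IsRegularlyVarying a α) : PotterBounds a α := by
  refine ⟨ha, fun ε hε => ?_⟩
  obtain ⟨N, hN⟩ := eventually_atTop.1
    (hreg.eventually_abs_le_of_le_two_mul ha (show 0 < ε / 4 by linarith))
  filter_upwards [eventually_ge_atTop (max N 1)] with n hn m
  have hNn : N ≤ n := (le_max_left _ _).trans hn
  have hn₁ : 1 ≤ n := (le_max_right _ _).trans hn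
  have : (0 : ℝ) < n := by exact_mod_cast hn₁
  induction m using Nat.strong_induction_on with
  | _ m ih =>
    intro hnm
    have hlog₀ := log_div_nonneg_of_le hn₁ hnm
    rcases le_or_gt m (2 * n) with h | h
    · exact (hN n hNn m hnm h).trans (by nlinarith)
    · obtain ⟨p, hp⟩ : ∃ p, p = (m + 1) / 2 := ⟨_, rfl⟩
      have hn_p := ih p (by omega) (by omega)
      have hp_m := hN p (by omega) m (by omega) (by omega)
      have hp₀ : (0 : ℝ) < p := by exact_mod_cast (show 0 < p by omega)
      have hm₀ : (0 : ℝ) < m := by exact_mod_cast (show 0 < m by omega)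
      have hlog : Real.log ((m : ℝ) / n) = Real.log (m / p) + Real.log (p / n) := by
        rw [← Real.log_mul (by positivity) (by positivity), div_mul_div_cancel₀ hp₀.ne']
      have hlog_mp : 1 / 4 ≤ Real.log ((m : ℝ) / p) := by
        have hinv : ((m : ℝ) / p)⁻¹ ≤ 3 / 4 := by
          rw [inv_div, div_le_div_iff₀ hm₀ (by norm_num)]
          exact_mod_cast (show p * 4 ≤ 3 * m by omega)
        linarith [Real.one_sub_inv_le_log_of_pos (show 0 < (m : ℝ) / p by positivity)]
      rw [hlog]
      calc |Real.log (a m) - Real.log (a n) - α * (Real.log (m / p) + Real.log (p / n))|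
          ≤ ε / 4 + ε * (1 + Real.log (p / n)) := by
            rw [abs_le] at *
            constructor <;> linarith
        _ ≤ ε * (1 + (Real.log (m / p) + Real.log (p / n))) := by nlinarith

end PotterTheorem

section PotterBounds

variable {c d : ℕ → ℝ} {ρ σ : ℝ}

lemma potterBounds_natCast : PotterBounds (fun n => (n : ℝ)) 1 where
  pos n hn := by exact_mod_cast hn
  eventually_abs_le ε hε := by
    filter_upwards [eventually_ge_atTop 1] with n hn m hnm
    have hlog₀ := log_div_nonneg_of_le hn hnm
    rw [Real.log_div (by norm_cast; omega) (by norm_cast; omega), one_mul, sub_self, abs_zero] at *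
    positivity

lemma PotterBounds.mul (hc : PotterBounds c ρ) (hd : PotterBounds d σ) :
    PotterBounds (fun n => c n * d n) (ρ + σ) where
  pos n hn := mul_pos (hc.pos n hn) (hd.pos n hn)
  eventually_abs_le ε hε := by
    filter_upwards [hc.eventually_abs_le (ε / 2) (by positivity),
      hd.eventually_abs_le (ε / 2) (by positivity), eventually_ge_atTop 1] with n hcn hdn hn m hnm
    have hc_nm := hcn m hnm
    have hd_nm := hdn m hnm
    have hlog (p : ℕ) (hp : 1 ≤ p) : Real.log (c p * d p) = Real.log (c p) + Real.log (d p) :=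
      Real.log_mul (hc.pos p hp).ne' (hd.pos p hp).ne'
    rw [hlog n hn, hlog m (hn.trans hnm)]
    rw [abs_le] at *
    constructor <;> linarith

lemma PotterBounds.inv (hc : PotterBounds c ρ) : PotterBounds (fun n => (c n)⁻¹) (-ρ) where
  pos n hn := inv_pos.2 (hc.pos n hn)
  eventually_abs_le ε hε := by
    filter_upwards [hc.eventually_abs_le ε hε] with n hcn m hnm
    have hc_nm := hcn m hnm
    rw [Real.log_inv, Real.log_inv]
    rw [abs_le] at *
    constructor <;> linarith

lemma PotterBounds.div (hc : PotterBounds c ρ) (hd : PotterBounds d σ) :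
    PotterBounds (fun n => c n / d n) (ρ - σ) := by
  simpa only [div_eq_mul_inv, sub_eq_add_neg] using hc.mul hd.inv

lemma PotterBounds.pow (hc : PotterBounds c ρ) {k : ℕ} (hk : 1 ≤ k) :
    PotterBounds (fun n => c n ^ k) (k * ρ) := by
  induction k, hk using Nat.le_induction with
  | base => simpa using hc
  | succ k _ ih =>
    simp only [pow_succ, Nat.cast_succ, add_mul, one_mul]
    exact ih.mul hc

lemma PotterBounds.of_tendsto_div (hc : PotterBounds c ρ) (hd : ∀ n : ℕ, 1 ≤ n → 0 < d n)
    {L : ℝ} (hL : 0 < L) (hdc : Tendsto (fun n => d n / c n) atTop (𝓝 L)) :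
    PotterBounds d ρ := by
  refine ⟨hd, fun ε hε => ?_⟩
  have hlog := Metric.tendsto_atTop.1 (hdc.log hL.ne') (ε / 4) (by positivity)
  obtain ⟨N, hN⟩ := hlog
  filter_upwards [hc.eventually_abs_le (ε / 2) (by positivity), eventually_ge_atTop N,
    eventually_ge_atTop 1] with n hcn hNn hn m hnm
  have hlog_div (p : ℕ) (hp : 1 ≤ p) :
      Real.log (d p / c p) = Real.log (d p) - Real.log (c p) :=
    Real.log_div (hd p hp).ne' (hc.pos p hp).ne'
  have hn_lim := hN n hNn
  have hm_lim := hN m (hNn.trans hnm)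
  have hc_nm := hcn m hnm
  have hlog₀ := mul_nonneg hε.le (log_div_nonneg_of_le hn hnm)
  rw [Real.dist_eq, hlog_div n hn, abs_lt] at hn_lim
  rw [Real.dist_eq, hlog_div m (hn.trans hnm), abs_lt] at hm_lim
  rw [abs_le] at *
  constructor <;> linarith

lemma rpow_bounds_of_abs_log_le {x y r ε : ℝ} (hx : 0 < x) (hy : 0 < y) (hr : 0 < r)
    (h : |Real.log y - Real.log x - ρ * Real.log r⁻¹| ≤ ε * (1 + Real.log r⁻¹)) :
    Real.exp (-ε) * y * r ^ (ρ + ε) ≤ x ∧ x ≤ Real.exp ε * y * r ^ (ρ - ε) := by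
  rw [Real.log_inv, abs_le] at h
  have hexp (τ e : ℝ) :
      Real.exp e * y * r ^ τ = Real.exp (e + Real.log y + Real.log r * τ) := by
    rw [Real.exp_add, Real.exp_add, Real.exp_log hy, Real.rpow_def_of_pos hr]
  constructor
  · rw [hexp, ← Real.le_log_iff_exp_le hx]
    linarith
  · rw [hexp, ← Real.log_le_iff_le_exp hx]
    linarith

lemma PotterBounds.exists_rpow_bounds (hc : PotterBounds c ρ) {ε : ℝ} (hε : 0 < ε) :
    ∃ N : ℕ, 1 ≤ N ∧ ∀ i n : ℕ, N ≤ i → i ≤ n →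
      Real.exp (-ε) * c n * ((i : ℝ) / n) ^ (ρ + ε) ≤ c i ∧
      c i ≤ Real.exp ε * c n * ((i : ℝ) / n) ^ (ρ - ε) := by
  obtain ⟨N, hN⟩ := eventually_atTop.1 (hc.eventually_abs_le ε hε)
  refine ⟨max N 1, le_max_right _ _, fun i n hi hin => ?_⟩
  have hi₁ : 1 ≤ i := (le_max_right _ _).trans hi
  have : (0 : ℝ) < i := by exact_mod_cast hi₁
  have hn₀ : (0 : ℝ) < n := by exact_mod_cast hi₁.trans hin
  refine rpow_bounds_of_abs_log_le (hc.pos i hi₁) (hc.pos n (hi₁.trans hin)) (by positivity) ?_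
  rw [inv_div]
  exact hN i ((le_max_left _ _).trans hi) n hin

lemma PotterBounds.tendsto_atTop (hc : PotterBounds c ρ) (hρ : 0 < ρ) :
    Tendsto c atTop atTop := by
  obtain ⟨N, hN₁, hN⟩ := hc.exists_rpow_bounds (half_pos hρ)
  have hN₀ : (0 : ℝ) < N := by exact_mod_cast hN₁
  have hcN : 0 < c N := hc.pos N hN₁
  have hlower : Tendsto
      (fun n : ℕ => c N * Real.exp (-(ρ / 2)) * ((n : ℝ) / N) ^ (ρ / 2)) atTop atTop :=
    ((tendsto_rpow_atTop (half_pos hρ)).comp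
      (tendsto_natCast_atTop_atTop.atTop_div_const hN₀)).const_mul_atTop (by positivity)
  refine tendsto_atTop_mono' _ ?_ hlower
  filter_upwards [eventually_ge_atTop N] with n hn
  have hn₀ : (0 : ℝ) < n := by exact_mod_cast hN₁.trans hn
  have hle := (hN N n le_rfl hn).2
  rw [sub_half] at hle
  calc c N * Real.exp (-(ρ / 2)) * ((n : ℝ) / N) ^ (ρ / 2)
      ≤ Real.exp (ρ / 2) * c n * ((N : ℝ) / n) ^ (ρ / 2) * Real.exp (-(ρ / 2)) *
          ((n : ℝ) / N) ^ (ρ / 2) := by gcongr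
    _ = Real.exp (ρ / 2 + -(ρ / 2)) * c n * ((N : ℝ) / n * (n / N)) ^ (ρ / 2) := by
        rw [Real.exp_add, Real.mul_rpow (by positivity) (by positivity)]
        ring
    _ = c n := by
        rw [add_neg_cancel, Real.exp_zero, one_mul, div_mul_div_cancel₀ hn₀.ne',
          div_self hN₀.ne', Real.one_rpow, mul_one]

lemma PotterBounds.eventually_forall_le_mul (hc : PotterBounds c ρ) (hρ : 0 < ρ) {M : ℝ}
    (hM : 1 < M) : ∀ᶠ n : ℕ in atTop, ∀ i : ℕ, 1 ≤ i → i ≤ n → c i ≤ M * c n := by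
  set ε := min ρ (Real.log M)
  have hε₀ : 0 < ε := lt_min hρ (Real.log_pos hM)
  obtain ⟨N, -, hN⟩ := hc.exists_rpow_bounds hε₀
  have hinit : ∀ᶠ n : ℕ in atTop, ∀ i ∈ Finset.Icc 1 N, c i ≤ c n :=
    (Finset.eventually_all _).2 fun i _ => (hc.tendsto_atTop hρ).eventually_ge_atTop (c i)
  filter_upwards [hinit] with n hn i hi hin
  have hn₀ : (0 : ℝ) < n := by exact_mod_cast hi.trans hin
  have hcn := hc.pos n (hi.trans hin)
  rcases le_total i N with hiN | hNi
  · nlinarith [hn i (Finset.mem_Icc.2 ⟨hi, hiN⟩)]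
  · have hrpow : ((i : ℝ) / n) ^ (ρ - ε) ≤ 1 := Real.rpow_le_one (by positivity)
      ((div_le_one hn₀).2 (by exact_mod_cast hin)) (sub_nonneg.2 (min_le_left _ _))
    have hexp : Real.exp ε ≤ M :=
      (Real.le_log_iff_exp_le (one_pos.trans hM)).1 (min_le_right _ _)
    calc c i ≤ Real.exp ε * c n * ((i : ℝ) / n) ^ (ρ - ε) := (hN i n hNi hin).2
      _ ≤ M * c n * 1 := by gcongr
      _ = M * c n := mul_one _

lemma PotterBounds.exists_eventually_forall_mul_le (hc : PotterBounds c ρ) (hρ : 0 ≤ ρ) {m : ℝ}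
    (hm₀ : 0 < m) (hm : m < 1) :
    ∃ δ : ℝ, 0 < δ ∧ ∀ᶠ n : ℕ in atTop, ∀ j : ℕ, (1 - δ) * n ≤ j → j ≤ n →
      m * c n ≤ c j := by
  set ε := -Real.log m / 2 with hε
  have hε₀ : 0 < ε := by linarith [Real.log_neg hm₀ hm]
  obtain ⟨N, hN₁, hN⟩ := hc.exists_rpow_bounds hε₀
  have hcont : Tendsto (fun δ : ℝ => Real.exp (-ε) * (1 - δ) ^ (ρ + ε)) (𝓝[>] 0)
      (𝓝 (Real.exp (-ε))) := by
    have : ContinuousAt (fun δ : ℝ => Real.exp (-ε) * (1 - δ) ^ (ρ + ε)) 0 :=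
      continuousAt_const.mul (ContinuousAt.rpow_const (by fun_prop) (Or.inl (by norm_num)))
    simpa using this.tendsto.mono_left nhdsWithin_le_nhds
  have hmε : m < Real.exp (-ε) := by
    rw [← Real.log_lt_iff_lt_exp hm₀]
    linarith
  obtain ⟨δ, ⟨hmδ, hδ_lt⟩, hδ₀⟩ := (((hcont.eventually_const_lt hmε).and
    ((eventually_lt_nhds (show (0 : ℝ) < 1 / 2 by norm_num)).filter_mono
      nhdsWithin_le_nhds)).and self_mem_nhdsWithin).exists
  refine ⟨δ, hδ₀, ?_⟩
  filter_upwards [eventually_ge_atTop (2 * N)] with n hn j hj hjn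
  have hn₀ : (0 : ℝ) < n := by exact_mod_cast (show 0 < n by omega)
  have hNj : N ≤ j := by
    have hn' : (2 : ℝ) * N ≤ n := by exact_mod_cast hn
    have : (N : ℝ) ≤ j := by nlinarith
    exact_mod_cast this
  have hcn := hc.pos n (by omega)
  have hjn' : 1 - δ ≤ (j : ℝ) / n := (le_div_iff₀ hn₀).2 hj
  calc m * c n ≤ Real.exp (-ε) * (1 - δ) ^ (ρ + ε) * c n := by gcongr
    _ = Real.exp (-ε) * c n * (1 - δ) ^ (ρ + ε) := by ring
    _ ≤ Real.exp (-ε) * c n * ((j : ℝ) / n) ^ (ρ + ε) := by gcongr; linarith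
    _ ≤ c j := (hN j n hNj hjn).1

end PotterBounds

/-! ### Karamata's theorem for sums -/

section Karamata

/-- Stolz–Cesàro. -/
lemma tendsto_sum_range_div_sum_range {f g : ℕ → ℝ} {L : ℝ} (hg : ∀ i, 0 < g i)
    (hsum : Tendsto (fun n => ∑ i ∈ Finset.range n, g i) atTop atTop)
    (hfg : Tendsto (fun i => f i / g i) atTop (𝓝 L)) :
    Tendsto (fun n => (∑ i ∈ Finset.range n, f i) / ∑ i ∈ Finset.range n, g i) atTop (𝓝 L) := by
  have hlittleO : (fun i => f i - L * g i) =o[atTop] g := by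
    refine (Asymptotics.isLittleO_iff_tendsto fun i h => absurd h (hg i).ne').2 ?_
    rw [← sub_self L]
    refine (hfg.sub_const L).congr fun i => ?_
    rw [sub_div, mul_div_cancel_right₀ _ (hg i).ne']
  have hlim := (hlittleO.sum_range (fun i => (hg i).le) hsum).tendsto_div_nhds_zero.add_const L
  rw [zero_add] at hlim
  refine hlim.congr' ?_
  filter_upwards [hsum.eventually_ne_atTop 0] with n hn
  rw [Finset.sum_sub_distrib, ← Finset.mul_sum, sub_div, mul_div_cancel_right₀ _ hn,
    sub_add_cancel]

lemma tendsto_add_one_rpow_div_sub_rpow {s : ℝ} (hs : s + 1 ≠ 0) :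
    Tendsto (fun i : ℕ => ((i : ℝ) + 1) ^ s / (((i : ℝ) + 1) ^ (s + 1) - (i : ℝ) ^ (s + 1)))
      atTop (𝓝 (1 / (s + 1))) := by
  have hderiv : HasDerivAt (fun x : ℝ => (1 - x) ^ (s + 1)) (-(s + 1)) 0 := by
    simpa using ((hasDerivAt_id (0 : ℝ)).const_sub 1).rpow_const (p := s + 1)
      (Or.inl (by norm_num))
  have hinv : Tendsto (fun i : ℕ => 1 / ((i : ℝ) + 1)) atTop (𝓝[≠] 0) :=
    tendsto_nhdsWithin_iff.2 ⟨tendsto_one_div_add_atTop_nhds_zero_nat,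
      Eventually.of_forall fun i => (Nat.one_div_pos_of_nat (α := ℝ)).ne'⟩
  have hslope := ((hderiv.tendsto_slope.comp hinv).neg).inv₀ (by simpa using hs)
  rw [neg_neg, inv_eq_one_div] at hslope
  refine hslope.congr fun i => ?_
  have hi : (0 : ℝ) < i + 1 := by positivity
  have hsub : (1 - 1 / ((i : ℝ) + 1)) = i / (i + 1) := by field_simp; ring
  have hpow : ((i : ℝ) + 1) ^ s ≠ 0 := (Real.rpow_pos_of_pos hi s).ne'
  rw [← inv_div]
  congr 1
  simp only [Function.comp_apply, slope_def_field, hsub, sub_zero, Real.one_rpow]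
  rw [Real.div_rpow (by positivity) hi.le, Real.rpow_add hi s 1, Real.rpow_one]
  field_simp
  ring

lemma tendsto_sum_rpow_div_rpow {s : ℝ} (hs : -1 < s) :
    Tendsto (fun n : ℕ => (∑ i ∈ Finset.Icc 1 n, (i : ℝ) ^ s) / (n : ℝ) ^ (s + 1)) atTop
      (𝓝 (1 / (s + 1))) := by
  have hs₁ : 0 < s + 1 := by linarith
  have htelescope (n : ℕ) :
      ∑ i ∈ Finset.range n, (((i : ℝ) + 1) ^ (s + 1) - (i : ℝ) ^ (s + 1)) = (n : ℝ) ^ (s + 1) := by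
    simpa [Real.zero_rpow hs₁.ne'] using
      Finset.sum_range_sub (fun i : ℕ => (i : ℝ) ^ (s + 1)) n
  have hlim := tendsto_sum_range_div_sum_range
    (fun i : ℕ => sub_pos.2 (Real.rpow_lt_rpow i.cast_nonneg (lt_add_one (i : ℝ)) hs₁))
    (by
      simp only [htelescope]
      exact (tendsto_rpow_atTop hs₁).comp tendsto_natCast_atTop_atTop)
    (tendsto_add_one_rpow_div_sub_rpow hs₁.ne')
  refine hlim.congr fun n => ?_
  rw [htelescope, Finset.range_eq_Ico, ← Finset.Ico_succ_right_eq_Icc, Nat.succ_eq_succ,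
    Nat.succ_eq_add_one, ← Finset.sum_Ico_add' (fun i : ℕ => (i : ℝ) ^ s) 0 n 1]
  simp only [Nat.cast_add, Nat.cast_one]

lemma sum_Icc_eq_sum_Ico_add {f : ℕ → ℝ} {N n : ℕ} (hN : 1 ≤ N) (hn : N ≤ n) :
    ∑ i ∈ Finset.Icc 1 n, f i = ∑ i ∈ Finset.Ico 1 N, f i + ∑ i ∈ Finset.Icc N n, f i := by
  rw [← Finset.Ico_add_one_right_eq_Icc, ← Finset.Ico_add_one_right_eq_Icc,
    Finset.sum_Ico_consecutive f hN (hn.trans (Nat.le_add_right n 1))]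

lemma tendsto_sum_Icc_div_sub_sum_Icc_div {f g : ℕ → ℝ} (hg : Tendsto g atTop atTop) {N : ℕ}
    (hN : 1 ≤ N) :
    Tendsto (fun n => (∑ i ∈ Finset.Icc 1 n, f i) / g n - (∑ i ∈ Finset.Icc N n, f i) / g n)
      atTop (𝓝 0) := by
  refine (hg.const_div_atTop (∑ i ∈ Finset.Ico 1 N, f i)).congr' ?_
  filter_upwards [eventually_ge_atTop N] with n hn
  rw [sum_Icc_eq_sum_Ico_add hN hn, add_div, add_sub_cancel_right]

lemma tendsto_sum_Icc_rpow_div_rpow {s : ℝ} (hs : -1 < s) {N : ℕ} (hN : 1 ≤ N) :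
    Tendsto (fun n : ℕ => (∑ i ∈ Finset.Icc N n, (i : ℝ) ^ s) / (n : ℝ) ^ (s + 1)) atTop
      (𝓝 (1 / (s + 1))) := by
  have hdrop := tendsto_sum_Icc_div_sub_sum_Icc_div (f := fun i : ℕ => (i : ℝ) ^ s)
    ((tendsto_rpow_atTop (show 0 < s + 1 by linarith)).comp tendsto_natCast_atTop_atTop) hN
  simpa using (tendsto_sum_rpow_div_rpow hs).sub hdrop

variable {c : ℕ → ℝ} {ρ : ℝ}

lemma PotterBounds.exists_sum_div_bounds (hc : PotterBounds c ρ) {ε : ℝ} (hε : 0 < ε) :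
    ∃ N : ℕ, 1 ≤ N ∧ ∀ n : ℕ, N ≤ n →
      Real.exp (-ε) * ((∑ i ∈ Finset.Icc N n, (i : ℝ) ^ (ρ + ε)) / (n : ℝ) ^ (ρ + ε + 1)) ≤
        (∑ i ∈ Finset.Icc N n, c i) / (n * c n) ∧
      (∑ i ∈ Finset.Icc N n, c i) / (n * c n) ≤
        Real.exp ε * ((∑ i ∈ Finset.Icc N n, (i : ℝ) ^ (ρ - ε)) / (n : ℝ) ^ (ρ - ε + 1)) := by
  obtain ⟨N, hN₁, hN⟩ := hc.exists_rpow_bounds hε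
  refine ⟨N, hN₁, fun n hn => ?_⟩
  have hn₀ : (0 : ℝ) < n := by exact_mod_cast hN₁.trans hn
  have hcn := hc.pos n (hN₁.trans hn)
  have hsum (e s : ℝ) : Real.exp e * ((∑ i ∈ Finset.Icc N n, (i : ℝ) ^ s) / (n : ℝ) ^ (s + 1)) =
      (∑ i ∈ Finset.Icc N n, Real.exp e * c n * ((i : ℝ) / n) ^ s) / (n * c n) := by
    have hdiv (i : ℕ) : ((i : ℝ) / n) ^ s = (i : ℝ) ^ s / (n : ℝ) ^ s :=
      Real.div_rpow i.cast_nonneg hn₀.le s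
    simp only [hdiv]
    rw [← Finset.mul_sum, ← Finset.sum_div, Real.rpow_add_one hn₀.ne']
    field_simp
  rw [hsum, hsum]
  constructor
  all_goals
    gcongr with i hi
    obtain ⟨hNi, hin⟩ := Finset.mem_Icc.1 hi
  · exact (hN i n hNi hin).1
  · exact (hN i n hNi hin).2

/-- For `ε > 0` the Potter bounds squeeze the normalised sums between those of the power sequences
with exponents `ρ + ε` and `ρ - ε`. -/
theorem PotterBounds.tendsto_sum_div (hc : PotterBounds c ρ) (hρ : -1 < ρ) :
    Tendsto (fun n : ℕ => (∑ i ∈ Finset.Icc 1 n, c i) / (n * c n)) atTop (𝓝 (1 / (ρ + 1))) := by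
  have hnc : Tendsto (fun n : ℕ => (n : ℝ) * c n) atTop atTop :=
    (potterBounds_natCast.mul hc).tendsto_atTop (by linarith)
  have hcont (τ : ℝ) : Tendsto (fun ε : ℝ => Real.exp (τ * ε) * (1 / (ρ - τ * ε + 1))) (𝓝[>] 0)
      (𝓝 (1 / (ρ + 1))) := by
    have : ContinuousAt (fun ε : ℝ => Real.exp (τ * ε) * (1 / (ρ - τ * ε + 1))) 0 :=
      ContinuousAt.mul (by fun_prop)
        (ContinuousAt.div (by fun_prop) (by fun_prop) (by simp; linarith))
    simpa using this.tendsto.mono_left nhdsWithin_le_nhds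
  rw [tendsto_order]
  constructor
  · intro b hb
    obtain ⟨ε, hbε, hε⟩ :=
      (((hcont (-1)).eventually_const_lt hb).and self_mem_nhdsWithin).exists
    have hε₀ : 0 < ε := hε
    rw [neg_one_mul, sub_neg_eq_add] at hbε
    obtain ⟨N, hN₁, hN⟩ := hc.exists_sum_div_bounds hε₀
    have hlower := ((tendsto_sum_Icc_rpow_div_rpow (s := ρ + ε) (by linarith) hN₁).const_mul
      (Real.exp (-ε))).add (tendsto_sum_Icc_div_sub_sum_Icc_div (f := c) hnc hN₁)
    rw [add_zero] at hlower
    filter_upwards [hlower.eventually_const_lt hbε, eventually_ge_atTop N] with n hbn hn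
    linarith [(hN n hn).1]
  · intro b hb
    obtain ⟨ε, ⟨hbε, hερ⟩, hε⟩ := ((((hcont 1).eventually_lt_const hb).and
      ((eventually_lt_nhds (show (0 : ℝ) < ρ + 1 by linarith)).filter_mono
        nhdsWithin_le_nhds)).and self_mem_nhdsWithin).exists
    have hε₀ : 0 < ε := hε
    rw [one_mul] at hbε
    obtain ⟨N, hN₁, hN⟩ := hc.exists_sum_div_bounds hε₀
    have hupper := ((tendsto_sum_Icc_rpow_div_rpow (s := ρ - ε) (by linarith) hN₁).const_mul
      (Real.exp ε)).add (tendsto_sum_Icc_div_sub_sum_Icc_div (f := c) hnc hN₁)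
    rw [add_zero] at hupper
    filter_upwards [hupper.eventually_lt_const hbε, eventually_ge_atTop N] with n hbn hn
    linarith [(hN n hn).2]

end Karamata

/-- The total length of `T n`. -/
def totalLength (a : ℕ → ℝ) (n : ℕ) : ℝ := ∑ i ∈ Finset.Icc 1 n, a i

section TotalLength

variable {a : ℕ → ℝ} {α : ℝ}

lemma totalLength_succ (a : ℕ → ℝ) (n : ℕ) :
    totalLength a (n + 1) = totalLength a n + a (n + 1) :=
  Finset.sum_Icc_succ_top (by omega) _

lemma le_totalLength (ha : ∀ n : ℕ, 1 ≤ n → 0 < a n) {i n : ℕ} (hi : 1 ≤ i) (hin : i ≤ n) :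
    a i ≤ totalLength a n :=
  Finset.single_le_sum (fun j hj => (ha j (Finset.mem_Icc.1 hj).1).le) (Finset.mem_Icc.2 ⟨hi, hin⟩)

lemma totalLength_pos (ha : ∀ n : ℕ, 1 ≤ n → 0 < a n) {n : ℕ} (hn : 1 ≤ n) :
    0 < totalLength a n :=
  (ha n hn).trans_le (le_totalLength ha hn le_rfl)

lemma totalLength_mono (ha : ∀ n : ℕ, 1 ≤ n → 0 < a n) : Monotone (totalLength a) :=
  fun _ _ h => Finset.sum_le_sum_of_subset_of_nonneg (Finset.Icc_subset_Icc_right h)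
    fun i hi _ => (ha i (Finset.mem_Icc.1 hi).1).le

lemma PotterBounds.tendsto_totalLength_div (h : PotterBounds a α) (hα : -1 < α) :
    Tendsto (fun n : ℕ => totalLength a n / (n * a n)) atTop (𝓝 (1 / (α + 1))) :=
  h.tendsto_sum_div hα

lemma PotterBounds.totalLength (h : PotterBounds a α) (hα : -1 < α) :
    PotterBounds (totalLength a) (1 + α) :=
  (potterBounds_natCast.mul h).of_tendsto_div (fun _ hn => totalLength_pos h.pos hn)
    (one_div_pos.2 (by linarith)) (h.tendsto_totalLength_div hα)

lemma PotterBounds.tendsto_div_totalLength (h : PotterBounds a α) (hα : -1 < α) :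
    Tendsto (fun n => a n / LineBreaking.totalLength a n) atTop (𝓝 0) := by
  have hlim := ((h.tendsto_totalLength_div hα).inv₀
    (one_div_pos.2 (by linarith)).ne').mul (tendsto_one_div_atTop_nhds_zero_nat (𝕜 := ℝ))
  rw [mul_zero] at hlim
  refine hlim.congr' ?_
  filter_upwards [eventually_ge_atTop 1] with n hn
  have : (0 : ℝ) < n := by exact_mod_cast hn
  rw [inv_div]
  field_simp

theorem PotterBounds.tendsto_sum_div_totalLength_mul_pow (h : PotterBounds a α) (hα : 0 < α)
    {k : ℕ} (hk : 1 ≤ k) :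
    Tendsto (fun n : ℕ =>
        ∑ i ∈ Finset.Icc 1 n, a i / LineBreaking.totalLength a i * (a i / a n) ^ k) atTop
      (𝓝 ((α + 1) / (α * k))) := by
  have hk₀ : (0 : ℝ) < k := by exact_mod_cast hk
  have hα₁ : -1 < α := by linarith
  have hsum := ((h.pow (Nat.le_add_left 1 k)).div (h.totalLength hα₁)).tendsto_sum_div
    (by push_cast; nlinarith)
  have hlim := hsum.mul ((h.tendsto_totalLength_div hα₁).inv₀ (by positivity))
  have hconst : 1 / (((k + 1 : ℕ) : ℝ) * α - (1 + α) + 1) * (1 / (α + 1))⁻¹ =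
      (α + 1) / (α * k) := by
    push_cast
    rw [show ((k : ℝ) + 1) * α - (1 + α) + 1 = α * k by ring]
    field_simp
  rw [hconst] at hlim
  refine hlim.congr' ?_
  filter_upwards [eventually_ge_atTop 1] with n hn
  have : (0 : ℝ) < n := by exact_mod_cast hn
  have han := h.pos n hn
  have hAn := totalLength_pos h.pos hn
  have hfactor : ∑ i ∈ Finset.Icc 1 n, a i / LineBreaking.totalLength a i * (a i / a n) ^ k =
      (∑ i ∈ Finset.Icc 1 n, a i ^ (k + 1) / LineBreaking.totalLength a i) / a n ^ k := by
    rw [Finset.sum_div]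
    refine Finset.sum_congr rfl fun i _ => ?_
    rw [div_pow, pow_succ]
    ring
  rw [hfactor]
  field_simp
  ring

end TotalLength

/-! ### The Laplace transform of the height of a uniform point -/

section ExponentialSeries

/-- The mean of `exp (x * u) - 1` for `u` uniform on `[0, 1]`: the relative effect of a new segment
on the Laplace transform of the heights. The division by zero gives the right value at `x = 0`. -/
noncomputable def glueGain (x : ℝ) : ℝ := (Real.exp x - 1 - x) / x

lemma hasSum_exp_sub_one (x : ℝ) :
    HasSum (fun k : ℕ => x ^ (k + 1) / ((k + 1).factorial : ℝ)) (Real.exp x - 1) := by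
  have hexp := NormedSpace.expSeries_div_hasSum_exp x
  rw [← Real.exp_eq_exp_ℝ, ← hasSum_nat_add_iff' 1] at hexp
  simpa using hexp

lemma hasSum_glueGain (x : ℝ) :
    HasSum (fun k : ℕ => x ^ (k + 1) / ((k + 2).factorial : ℝ)) (glueGain x) := by
  rcases eq_or_ne x 0 with rfl | hx
  · simp [glueGain]
  have hexp := hasSum_exp_sub_one x
  rw [← hasSum_nat_add_iff' 1] at hexp
  have hdiv := hexp.div_const x
  simp only [Finset.sum_range_one, zero_add, pow_one, Nat.factorial_one, Nat.cast_one,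
    div_one] at hdiv
  refine hdiv.congr_fun fun k => ?_
  rw [pow_succ x (k + 1)]
  field_simp

lemma glueGain_nonneg {x : ℝ} (hx : 0 ≤ x) : 0 ≤ glueGain x :=
  div_nonneg (by linarith [Real.add_one_le_exp x]) hx

lemma abs_glueGain_le (x : ℝ) : |glueGain x| ≤ |x| * Real.exp |x| := by
  have hexp := (NormedSpace.expSeries_div_hasSum_exp |x|).mul_left |x|
  rw [← Real.exp_eq_exp_ℝ] at hexp
  refine (hasSum_glueGain x).norm_le_of_bounded hexp fun k => ?_
  rw [norm_div, norm_pow, Real.norm_eq_abs, Real.norm_natCast, pow_succ', mul_div_assoc]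
  gcongr
  omega

lemma integral_pow_mul_one_sub (k : ℕ) :
    ∫ u in (0 : ℝ)..1, u ^ k * (1 - u) = 1 / ((k + 1) * (k + 2)) := by
  have hexpand (u : ℝ) : u ^ k * (1 - u) = u ^ k - u ^ (k + 1) := by ring
  simp_rw [hexpand]
  rw [intervalIntegral.integral_sub (by simp) (by simp), integral_pow, integral_pow]
  push_cast
  simp only [one_pow, ne_eq, Nat.add_eq_zero_iff, one_ne_zero, and_false, not_false_eq_true,
    zero_pow, sub_zero]
  field_simp
  ring

lemma hasSum_integral_exp_sub_one (lam : ℝ) :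
    HasSum (fun k : ℕ => lam ^ (k + 1) / ((k + 1).factorial : ℝ) * (1 / ((k + 1) * (k + 2))))
      (∫ u in (0 : ℝ)..1, (Real.exp (lam * u) - 1) * ((1 - u) / u)) := by
  have hseries := intervalIntegral.hasSum_integral_of_dominated_convergence (μ := volume) (a := 0)
    (b := 1) (F := fun (k : ℕ) u => lam ^ (k + 1) / ((k + 1).factorial : ℝ) * (u ^ k * (1 - u)))
    (f := fun u => (Real.exp (lam * u) - 1) * ((1 - u) / u))
    (fun k _ => |lam| ^ (k + 1) / ((k + 1).factorial : ℝ))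
    (fun k => by fun_prop)
    (fun k => Eventually.of_forall fun u hu => by
      obtain ⟨hu₀, hu₁⟩ := Set.uIoc_of_le (zero_le_one' ℝ) ▸ hu
      rw [norm_mul, norm_div, norm_pow, Real.norm_eq_abs, Real.norm_natCast, norm_mul, norm_pow,
        Real.norm_of_nonneg hu₀.le, Real.norm_of_nonneg (sub_nonneg.2 hu₁)]
      exact mul_le_of_le_one_right (by positivity)
        (mul_le_one₀ (pow_le_one₀ hu₀.le hu₁) (sub_nonneg.2 hu₁) (sub_le_self 1 hu₀.le)))
    (Eventually.of_forall fun _ _ => (hasSum_exp_sub_one |lam|).summable) (by simp)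
    (Eventually.of_forall fun u hu => by
      obtain ⟨hu₀, -⟩ := Set.uIoc_of_le (zero_le_one' ℝ) ▸ hu
      refine ((hasSum_exp_sub_one (lam * u)).mul_right ((1 - u) / u)).congr_fun fun k => ?_
      rw [mul_pow, pow_succ u k]
      field_simp)
  simpa only [intervalIntegral.integral_const_mul, integral_pow_mul_one_sub] using hseries

lemma hasSum_phi {α : ℝ} (hα : 0 < α) (lam : ℝ) :
    HasSum (fun k : ℕ => lam ^ (k + 1) / ((k + 2).factorial : ℝ) * ((α + 1) / (α * (k + 1 : ℕ))))
      (phi α lam) := by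
  refine ((hasSum_integral_exp_sub_one lam).mul_left ((α + 1) / α)).congr_fun fun k => ?_
  rw [Nat.factorial_succ (k + 1)]
  push_cast
  rw [show (k : ℝ) + 1 + 1 = k + 2 by ring]
  field_simp

end ExponentialSeries

section InfinitesimalProducts

lemma abs_log_one_add_sub_le {x : ℝ} (hx : |x| ≤ 1 / 2) : |Real.log (1 + x) - x| ≤ 2 * x ^ 2 := by
  have htaylor := Real.abs_log_sub_add_sum_range_le (x := -x) (by rw [abs_neg]; linarith) 1
  simp only [Finset.sum_range_one, zero_add, pow_one, Nat.cast_zero, div_one, sub_neg_eq_add,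
    abs_neg] at htaylor
  calc |Real.log (1 + x) - x| = |-x + Real.log (1 + x)| := by congr 1; ring
    _ ≤ |x| ^ (1 + 1) / (1 - |x|) := htaylor
    _ ≤ 2 * x ^ 2 := by
      rw [div_le_iff₀ (by linarith), one_add_one_eq_two, sq_abs]
      nlinarith [sq_nonneg x]

variable {ι : Type*} {l : Filter ι} {κ : Type*} {x : ι → κ → ℝ} {s : ι → Finset κ} {S C : ℝ}

lemma tendsto_sum_log_one_add_sub
    (hmax : ∀ ε : ℝ, 0 < ε → ∀ᶠ n in l, ∀ i ∈ s n, |x n i| ≤ ε)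
    (habs : ∀ᶠ n in l, ∑ i ∈ s n, |x n i| ≤ C) :
    Tendsto (fun n => ∑ i ∈ s n, (Real.log (1 + x n i) - x n i)) l (𝓝 0) := by
  rw [Metric.tendsto_nhds]
  intro ε hε
  set δ := min (1 / 2) (ε / (4 * (|C| + 1)))
  filter_upwards [hmax δ (by positivity), habs] with n hδ hC
  rw [dist_zero_right, Real.norm_eq_abs]
  calc |∑ i ∈ s n, (Real.log (1 + x n i) - x n i)|
      ≤ ∑ i ∈ s n, 2 * (ε / (4 * (|C| + 1))) * |x n i| := by
        refine (Finset.abs_sum_le_sum_abs _ _).trans (Finset.sum_le_sum fun i hi => ?_)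
        refine (abs_log_one_add_sub_le ((hδ i hi).trans (min_le_left _ _))).trans ?_
        rw [← sq_abs, pow_two, ← mul_assoc]
        gcongr
        exact (hδ i hi).trans (min_le_right _ _)
    _ ≤ 2 * (ε / (4 * (|C| + 1))) * |C| := by
        rw [← Finset.mul_sum]
        gcongr
        exact hC.trans (le_abs_self C)
    _ = ε * (|C| / (2 * (|C| + 1))) := by field_simp; norm_num
    _ < ε := mul_lt_of_lt_one_right hε ((div_lt_one (by positivity)).2 (by linarith [abs_nonneg C]))

lemma tendsto_prod_one_add (hS : Tendsto (fun n => ∑ i ∈ s n, x n i) l (𝓝 S))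
    (hmax : ∀ ε : ℝ, 0 < ε → ∀ᶠ n in l, ∀ i ∈ s n, |x n i| ≤ ε)
    (habs : ∀ᶠ n in l, ∑ i ∈ s n, |x n i| ≤ C) :
    Tendsto (fun n => ∏ i ∈ s n, (1 + x n i)) l (𝓝 (Real.exp S)) := by
  have hlim := (Real.continuous_exp.tendsto _).comp ((tendsto_sum_log_one_add_sub hmax habs).add hS)
  rw [zero_add] at hlim
  refine hlim.congr' ?_
  filter_upwards [hmax (1 / 2) (by norm_num)] with n hn
  rw [Function.comp_apply, ← Finset.sum_add_distrib, Real.exp_sum]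
  refine Finset.prod_congr rfl fun i hi => ?_
  rw [sub_add_cancel, Real.exp_log]
  linarith [neg_abs_le (x n i), hn i hi]

end InfinitesimalProducts

/-- The Laplace transform at `θ` of the height of a uniform point of `T n`, see
`integral_exp_pointHeight`. -/
noncomputable def heightMgf (a : ℕ → ℝ) (n : ℕ) (θ : ℝ) : ℝ :=
  ∏ i ∈ Finset.Icc 1 n, (1 + a i / totalLength a i * glueGain (θ * a i))

section HeightMgf

variable {a : ℕ → ℝ} {α M : ℝ} {n : ℕ}

lemma div_totalLength_mul_pow_nonneg (ha : ∀ n : ℕ, 1 ≤ n → 0 < a n) (k : ℕ) {i : ℕ}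
    (hi : i ∈ Finset.Icc 1 n) : 0 ≤ a i / totalLength a i * (a i / a n) ^ k := by
  obtain ⟨hi₁, hin⟩ := Finset.mem_Icc.1 hi
  have := ha i hi₁
  have := ha n (hi₁.trans hin)
  have := totalLength_pos ha hi₁
  positivity

lemma abs_weight_mul_glueGain_le (ha : ∀ n : ℕ, 1 ≤ n → 0 < a n)
    (hM : ∀ i, 1 ≤ i → i ≤ n → a i ≤ M * a n) (lam : ℝ) {i : ℕ} (hi : i ∈ Finset.Icc 1 n) :
    |a i / totalLength a i * glueGain (lam / a n * a i)| ≤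
      |lam| * Real.exp (|lam| * M) * (a i / totalLength a i * (a i / a n)) := by
  obtain ⟨hi₁, hin⟩ := Finset.mem_Icc.1 hi
  have hai := ha i hi₁
  have han := ha n (hi₁.trans hin)
  have hAi := totalLength_pos ha hi₁
  have hratio : a i / a n ≤ M := (div_le_iff₀ han).2 (hM i hi₁ hin)
  have harg : |lam / a n * a i| = |lam| * (a i / a n) := by
    rw [abs_mul, abs_div, abs_of_pos hai, abs_of_pos han]; ring
  have hgain := abs_glueGain_le (lam / a n * a i)
  rw [harg] at hgain
  rw [abs_mul, abs_of_pos (div_pos hai hAi)]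
  calc a i / totalLength a i * |glueGain (lam / a n * a i)|
      ≤ a i / totalLength a i * (|lam| * (a i / a n) * Real.exp (|lam| * M)) := by
        refine mul_le_mul_of_nonneg_left (hgain.trans ?_) (by positivity)
        gcongr
    _ = _ := by ring

lemma sum_abs_weight_mul_glueGain_le (ha : ∀ n : ℕ, 1 ≤ n → 0 < a n)
    (hM : ∀ i, 1 ≤ i → i ≤ n → a i ≤ M * a n) (lam : ℝ) :
    ∑ i ∈ Finset.Icc 1 n, |a i / totalLength a i * glueGain (lam / a n * a i)| ≤
      |lam| * Real.exp (|lam| * M) *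
        ∑ i ∈ Finset.Icc 1 n, a i / totalLength a i * (a i / a n) := by
  rw [Finset.mul_sum]
  exact Finset.sum_le_sum fun i hi => abs_weight_mul_glueGain_le ha hM lam hi

lemma sum_weight_mul_pow_succ_le (ha : ∀ n : ℕ, 1 ≤ n → 0 < a n)
    (hM : ∀ i, 1 ≤ i → i ≤ n → a i ≤ M * a n) (k : ℕ) :
    ∑ i ∈ Finset.Icc 1 n, a i / totalLength a i * (a i / a n) ^ (k + 1) ≤
      M ^ k * ∑ i ∈ Finset.Icc 1 n, a i / totalLength a i * (a i / a n) := by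
  rw [Finset.mul_sum]
  refine Finset.sum_le_sum fun i hi => ?_
  obtain ⟨hi₁, hin⟩ := Finset.mem_Icc.1 hi
  have hai := ha i hi₁
  have han := ha n (hi₁.trans hin)
  have hAi := totalLength_pos ha hi₁
  have hratio : a i / a n ≤ M := (div_le_iff₀ han).2 (hM i hi₁ hin)
  calc a i / totalLength a i * (a i / a n) ^ (k + 1)
      = (a i / a n) ^ k * (a i / totalLength a i * (a i / a n)) := by ring
    _ ≤ M ^ k * (a i / totalLength a i * (a i / a n)) := by gcongr

lemma sum_weight_mul_glueGain_eq_tsum (a : ℕ → ℝ) (n : ℕ) (lam : ℝ) :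
    ∑ i ∈ Finset.Icc 1 n, a i / totalLength a i * glueGain (lam / a n * a i) =
      ∑' k : ℕ, lam ^ (k + 1) / ((k + 2).factorial : ℝ) *
        ∑ i ∈ Finset.Icc 1 n, a i / totalLength a i * (a i / a n) ^ (k + 1) := by
  refine (HasSum.tsum_eq ?_).symm
  simp_rw [Finset.mul_sum]
  refine hasSum_sum fun i _ => ?_
  refine ((hasSum_glueGain (lam / a n * a i)).mul_left _).congr_fun fun k => ?_
  rw [mul_pow, div_pow, div_pow]
  ring

lemma PotterBounds.eventually_sum_weight_le (h : PotterBounds a α) (hα : 0 < α) :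
    ∀ᶠ n : ℕ in atTop, ∑ i ∈ Finset.Icc 1 n, a i / LineBreaking.totalLength a i * (a i / a n) ≤
      (α + 1) / α + 1 := by
  have hlim := h.tendsto_sum_div_totalLength_mul_pow hα le_rfl
  simp only [pow_one, Nat.cast_one, mul_one] at hlim
  exact hlim.eventually (ge_mem_nhds (lt_add_one _))

lemma PotterBounds.tendsto_sum_weight_mul_glueGain (h : PotterBounds a α) (hα : 0 < α) (lam : ℝ) :
    Tendsto (fun n : ℕ => ∑ i ∈ Finset.Icc 1 n,
        a i / LineBreaking.totalLength a i * glueGain (lam / a n * a i)) atTop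
      (𝓝 (phi α lam)) := by
  simp_rw [sum_weight_mul_glueGain_eq_tsum]
  rw [← (hasSum_phi hα lam).tsum_eq]
  set C := (α + 1) / α + 1
  refine tendsto_tsum_of_dominated_convergence
    (bound := fun k : ℕ => |lam| ^ (k + 1) / ((k + 2).factorial : ℝ) * (2 ^ k * C)) ?_
    (fun k => (h.tendsto_sum_div_totalLength_mul_pow hα (Nat.le_add_left 1 k)).const_mul _) ?_
  · refine ((hasSum_glueGain (|lam| * 2)).summable.mul_right (C / 2)).congr fun k => ?_
    rw [mul_pow, pow_succ (2 : ℝ)]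
    ring
  · filter_upwards [h.eventually_forall_le_mul hα one_lt_two, h.eventually_sum_weight_le hα]
      with n hn hCn k
    rw [norm_mul, norm_div, norm_pow, Real.norm_eq_abs, Real.norm_natCast, Real.norm_of_nonneg
      (Finset.sum_nonneg fun i hi => div_totalLength_mul_pow_nonneg h.pos (k + 1) hi)]
    gcongr
    exact (sum_weight_mul_pow_succ_le h.pos hn k).trans (by gcongr)

lemma PotterBounds.eventually_weight_mul_div_le (h : PotterBounds a α) (hα : 0 < α) {η : ℝ}
    (hη : 0 < η) :
    ∀ᶠ n : ℕ in atTop, ∀ i ∈ Finset.Icc 1 n,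
      a i / LineBreaking.totalLength a i * (a i / a n) ≤ η := by
  obtain ⟨N, hN⟩ := eventually_atTop.1
    ((h.tendsto_div_totalLength (by linarith)).eventually (gt_mem_nhds (half_pos hη)))
  filter_upwards [h.eventually_forall_le_mul hα one_lt_two,
    (h.tendsto_atTop hα).eventually_ge_atTop (LineBreaking.totalLength a N / η)]
    with n hn hlarge i hi
  obtain ⟨hi₁, hin⟩ := Finset.mem_Icc.1 hi
  have hai := h.pos i hi₁
  have han := h.pos n (hi₁.trans hin)
  have hAi := totalLength_pos h.pos hi₁
  rcases le_total N i with hNi | hiN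
  · calc a i / LineBreaking.totalLength a i * (a i / a n) ≤ η / 2 * 2 :=
          mul_le_mul (hN i hNi).le ((div_le_iff₀ han).2 (hn i hi₁ hin)) (by positivity)
            (by positivity)
      _ = η := by ring
  · have hratio : a i / a n ≤ η := by
      rw [div_le_iff₀ han]
      rw [div_le_iff₀ hη] at hlarge
      linarith [le_totalLength h.pos hi₁ hiN]
    calc a i / LineBreaking.totalLength a i * (a i / a n) ≤ 1 * η := by
          gcongr
          exact (div_le_one hAi).2 (le_totalLength h.pos hi₁ le_rfl)
      _ = η := one_mul η

theorem PotterBounds.tendsto_heightMgf (h : PotterBounds a α) (hα : 0 < α) (lam : ℝ) :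
    Tendsto (fun n : ℕ => heightMgf a n (lam / a n)) atTop (𝓝 (Real.exp (phi α lam))) := by
  have hle := h.eventually_forall_le_mul hα one_lt_two
  set K := |lam| * Real.exp (|lam| * 2)
  have hK : 0 ≤ K := by positivity
  refine tendsto_prod_one_add (C := K * ((α + 1) / α + 1))
    (h.tendsto_sum_weight_mul_glueGain hα lam) (fun ε hε => ?_) ?_
  · filter_upwards [hle, h.eventually_weight_mul_div_le hα (show 0 < ε / (K + 1) by positivity)]
      with n hn hsmall i hi
    calc |a i / LineBreaking.totalLength a i * glueGain (lam / a n * a i)|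
        ≤ K * (a i / LineBreaking.totalLength a i * (a i / a n)) :=
          abs_weight_mul_glueGain_le h.pos hn lam hi
      _ ≤ (K + 1) * (ε / (K + 1)) := by
          gcongr
          · simpa using div_totalLength_mul_pow_nonneg h.pos 1 hi
          · linarith
          · exact hsmall i hi
      _ = ε := by field_simp
  · filter_upwards [hle, h.eventually_sum_weight_le hα] with n hn hCn
    exact (sum_abs_weight_mul_glueGain_le h.pos hn lam).trans (by gcongr)

lemma heightMgf_le_exp (ha : ∀ n : ℕ, 1 ≤ n → 0 < a n) {θ : ℝ} (hθ : 0 ≤ θ) :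
    heightMgf a n θ ≤
      Real.exp (∑ i ∈ Finset.Icc 1 n, a i / totalLength a i * glueGain (θ * a i)) := by
  rw [Real.exp_sum]
  refine Finset.prod_le_prod (fun i hi => ?_) fun i _ => ?_
  · obtain ⟨hi₁, -⟩ := Finset.mem_Icc.1 hi
    have hai := ha i hi₁
    have := totalLength_pos ha hi₁
    have := glueGain_nonneg (mul_nonneg hθ hai.le)
    positivity
  · rw [add_comm]
    exact Real.add_one_le_exp _

lemma PotterBounds.exists_heightMgf_le (h : PotterBounds a α) (hα : 0 < α) (hM : 1 < M) :
    ∃ C : ℝ, 0 < C ∧ ∀ᶠ n : ℕ in atTop, ∀ lam : ℝ, 0 ≤ lam →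
      heightMgf a n (lam / a n) ≤ Real.exp (C * lam * Real.exp (lam * M)) := by
  refine ⟨(α + 1) / α + 1, by positivity, ?_⟩
  filter_upwards [h.eventually_forall_le_mul hα hM, h.eventually_sum_weight_le hα,
    eventually_ge_atTop 1] with n hn hCn hn₁ lam hlam
  refine (heightMgf_le_exp h.pos (div_nonneg hlam (h.pos n hn₁).le)).trans (Real.exp_le_exp.2 ?_)
  calc ∑ i ∈ Finset.Icc 1 n, a i / LineBreaking.totalLength a i * glueGain (lam / a n * a i)
      ≤ |lam| * Real.exp (|lam| * M) *
          ∑ i ∈ Finset.Icc 1 n, a i / LineBreaking.totalLength a i * (a i / a n) :=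
        (Finset.sum_le_sum fun i _ => le_abs_self _).trans
          (sum_abs_weight_mul_glueGain_le h.pos hn lam)
    _ ≤ |lam| * Real.exp (|lam| * M) * ((α + 1) / α + 1) := by gcongr
    _ = ((α + 1) / α + 1) * lam * Real.exp (lam * M) := by rw [abs_of_nonneg hlam]; ring

end HeightMgf

/-! ### Heights in the tree -/

/-- The height of the base of the segment `b j` when the gluing points are given by `g`. -/
noncomputable def baseHeight (g : ℕ → ℕ × ℝ) (j : ℕ) : ℝ :=
  if j ≤ 1 then 0 else treeDist g (j - 1) (g (j - 1)) root

section Deterministic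

variable {a : ℕ → ℝ} {g : ℕ → ℕ × ℝ} {n j : ℕ} {x : ℕ × ℝ}

lemma treeDist_root_one (g : ℕ → ℕ × ℝ) (x : ℕ × ℝ) :
    treeDist g 1 x root = if x.1 = 1 then |x.2| else 0 := by
  simp [treeDist, root]

lemma treeDist_root_succ (g : ℕ → ℕ × ℝ) (hn : 1 ≤ n) (x : ℕ × ℝ) :
    treeDist g (n + 1) x root =
      if x.1 = n + 1 then x.2 + treeDist g n (g n) root else treeDist g n x root := by
  have hroot : ¬ root.1 = n + 1 := by simp only [root]; omega
  simp only [treeDist, hroot, if_false]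

@[simp]
lemma baseHeight_one (g : ℕ → ℕ × ℝ) : baseHeight g 1 = 0 := by simp [baseHeight]

lemma baseHeight_succ (g : ℕ → ℕ × ℝ) (hj : 1 ≤ j) :
    baseHeight g (j + 1) = treeDist g j (g j) root := by
  simp [baseHeight, show ¬ j + 1 ≤ 1 by omega]

lemma treeDist_root_eq (g : ℕ → ℕ × ℝ) (hj : 1 ≤ j) (hjn : j ≤ n) {s : ℝ} (hs : 0 ≤ s) :
    treeDist g n (j, s) root = s + baseHeight g j := by
  induction n, (hj.trans hjn) using Nat.le_induction with
  | base =>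
    obtain rfl : j = 1 := by omega
    simp [treeDist_root_one, abs_of_nonneg hs]
  | succ n hn ih =>
    rw [treeDist_root_succ g hn]
    rcases eq_or_ne j (n + 1) with rfl | hne
    · simp [baseHeight_succ g hn]
    · rw [if_neg hne, ih (by omega)]

lemma treeDist_root_of_mem (g : ℕ → ℕ × ℝ) (hx : x ∈ treePoints a n) :
    treeDist g n x root = x.2 + baseHeight g x.1 :=
  treeDist_root_eq g hx.1.1 hx.1.2 hx.2.1

lemma treeDist_root_mem_Icc (ha : ∀ n : ℕ, 1 ≤ n → 0 < a n)
    (hg : ∀ k : ℕ, 1 ≤ k → g k ∈ treePoints a k) (hx : x ∈ treePoints a n) :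
    treeDist g n x root ∈ Set.Icc 0 (totalLength a n) := by
  induction n, (hx.1.1.trans hx.1.2) using Nat.le_induction generalizing x with
  | base =>
    have hfst : x.1 = 1 := le_antisymm hx.1.2 hx.1.1
    obtain ⟨hx₀, hxa⟩ := hx.2
    rw [treeDist_root_one, if_pos hfst, abs_of_nonneg hx₀]
    exact ⟨hx₀, by simpa [totalLength, hfst] using hxa⟩
  | succ n hn ih =>
    rw [treeDist_root_succ g hn]
    split_ifs with hfst
    · obtain ⟨hbase₀, hbase⟩ := ih (hg n hn)
      obtain ⟨hx₀, hxa⟩ := hx.2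
      rw [hfst] at hxa
      exact ⟨by positivity, by linarith [totalLength_succ a n]⟩
    · have hxn := ih ⟨⟨hx.1.1, by have := hx.1.2; omega⟩, hx.2⟩
      exact ⟨hxn.1, hxn.2.trans (totalLength_mono ha n.le_succ)⟩

lemma baseHeight_mem_Icc (ha : ∀ n : ℕ, 1 ≤ n → 0 < a n)
    (hg : ∀ k : ℕ, 1 ≤ k → g k ∈ treePoints a k) (hj : 1 ≤ j) :
    baseHeight g j ∈ Set.Icc 0 (totalLength a (j - 1)) := by
  obtain ⟨k, rfl⟩ : ∃ k, j = k + 1 := ⟨j - 1, by omega⟩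
  rcases Nat.eq_zero_or_pos k with rfl | hk
  · simp [totalLength]
  · rw [baseHeight_succ g hk]
    exact treeDist_root_mem_Icc ha hg (hg k hk)

lemma dependsOn_treeDist_root (n : ℕ) (x : ℕ × ℝ) :
    DependsOn (fun g => treeDist g n x root) (Set.Ico 1 n) := by
  intro g g' hgg'
  induction n generalizing x with
  | zero => rfl
  | succ n ih =>
    rcases Nat.eq_zero_or_pos n with rfl | hn
    · simp only [zero_add, treeDist_root_one]
    · have hprev : ∀ k ∈ Set.Ico 1 n, g k = g' k := fun k hk =>
        hgg' k (Set.Ico_subset_Ico_right n.le_succ hk)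
      simp only [treeDist_root_succ _ hn, ih _ hprev, hgg' n ⟨hn, n.lt_succ_self⟩]

lemma dependsOn_baseHeight (j : ℕ) : DependsOn (fun g => baseHeight g j) (Set.Ico 1 j) := by
  intro g g' hgg'
  simp only [baseHeight]
  split_ifs with hj
  · rfl
  · rw [hgg' (j - 1) ⟨by omega, by omega⟩]
    exact dependsOn_treeDist_root (j - 1) _ fun k hk =>
      hgg' k (Set.Ico_subset_Ico_right (Nat.sub_le j 1) hk)

end Deterministic

lemma measurable_treeDist_root {Ω : Type*} [MeasurableSpace Ω] {Y : ℕ → Ω → ℕ × ℝ} {n : ℕ}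
    (hY : ∀ k ∈ Set.Ico 1 n, Measurable (Y k)) {Z : Ω → ℕ × ℝ} (hZ : Measurable Z) :
    Measurable fun ω => treeDist (fun k => Y k ω) n (Z ω) root := by
  induction n generalizing Z with
  | zero => exact measurable_const
  | succ n ih =>
    have hsegment (j : ℕ) : MeasurableSet {ω | (Z ω).1 = j} :=
      (measurable_fst.comp hZ) (measurableSet_singleton j)
    rcases Nat.eq_zero_or_pos n with rfl | hn
    · simp only [zero_add, treeDist_root_one]
      exact Measurable.ite (hsegment 1) (measurable_snd.comp hZ).abs measurable_const
    · have hprev : ∀ k ∈ Set.Ico 1 n, Measurable (Y k) := fun k hk =>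
        hY k (Set.Ico_subset_Ico_right n.le_succ hk)
      simp only [treeDist_root_succ _ hn]
      exact Measurable.ite (hsegment (n + 1))
        ((measurable_snd.comp hZ).add (ih hprev (hY n ⟨hn, n.lt_succ_self⟩))) (ih hprev hZ)

lemma measurable_baseHeight (j : ℕ) : Measurable fun g : ℕ → ℕ × ℝ => baseHeight g j := by
  unfold baseHeight
  split_ifs
  · exact measurable_const
  · exact measurable_treeDist_root (Y := fun k (g : ℕ → ℕ × ℝ) => g k)
      (fun k _ => measurable_pi_apply k) (measurable_pi_apply (j - 1))

lemma comp_eq_comp_updateFinset {Ω β : Type*} {Y : ℕ → Ω → ℕ × ℝ} {n : ℕ}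
    {F : (ℕ → ℕ × ℝ) → β} (hF : DependsOn F (Set.Ico 1 n)) :
    (fun ω => F fun k => Y k ω) =
      (F ∘ Function.updateFinset (fun _ => (0, 0)) (Finset.Ico 1 n)) ∘
        fun ω (k : Finset.Ico 1 n) => Y k ω := by
  funext ω
  refine hF fun k hk => ?_
  rw [Function.updateFinset, dif_pos (Finset.mem_Ico.2 hk)]

section UniformPoint

variable {Ω : Type*} [MeasurableSpace Ω] {P : Measure Ω} {a : ℕ → ℝ} {Y : ℕ → Ω → ℕ × ℝ} {n : ℕ}
  {Z : Ω → ℕ × ℝ}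

lemma IsGluingSequence.measurable (hY : IsGluingSequence P a Y) {k : ℕ} (hk : 1 ≤ k) :
    Measurable (Y k) := (hY k hk).1

lemma IsGluingSequence.measurable_comp (hY : IsGluingSequence P a Y) {β : Type*}
    [MeasurableSpace β] {F : (ℕ → ℕ × ℝ) → β} (hFm : Measurable F)
    (hF : DependsOn F (Set.Ico 1 n)) : Measurable fun ω => F fun k => Y k ω := by
  rw [comp_eq_comp_updateFinset hF]
  exact (hFm.comp measurable_updateFinset).comp (measurable_pi_iff.2 fun k =>
    hY.measurable (Finset.mem_Ico.1 k.2).1)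

lemma IsUniformPoint.indepFun_comp (hZ : IsUniformPoint P a Y n Z) {β γ : Type*}
    [MeasurableSpace β] [MeasurableSpace γ] {f : ℕ × ℝ → γ} (hf : Measurable f)
    {F : (ℕ → ℕ × ℝ) → β} (hFm : Measurable F) (hF : DependsOn F (Set.Ico 1 n)) :
    IndepFun (fun ω => f (Z ω)) (fun ω => F fun k => Y k ω) P := by
  rw [comp_eq_comp_updateFinset hF]
  exact hZ.2.2.comp hf (hFm.comp measurable_updateFinset)

lemma measurableSet_treePoints (a : ℕ → ℝ) (n : ℕ) : MeasurableSet (treePoints a n) := by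
  have hunion : treePoints a n = ⋃ i ∈ Set.Icc 1 n, ({i} : Set ℕ) ×ˢ Set.Icc 0 (a i) := by
    ext x
    simp only [treePoints, Set.mem_ofPred_eq, Set.mem_iUnion, Set.mem_prod, Set.mem_singleton_iff,
      exists_prop]
    exact ⟨fun h => ⟨x.1, h.1, rfl, h.2⟩, fun ⟨i, hi, hxi, hx⟩ => hxi ▸ ⟨hi, hxi ▸ hx⟩⟩
  rw [hunion]
  exact MeasurableSet.biUnion (Set.to_countable _) fun i _ =>
    (measurableSet_singleton i).prod measurableSet_Icc

lemma ae_uniformMeasure_mem (a : ℕ → ℝ) (n : ℕ) :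
    ∀ᵐ x ∂uniformMeasure a n, x ∈ treePoints a n := by
  refine Measure.ae_smul_measure ?_ _
  rw [ae_iff, Measure.finsetSum_apply]
  refine Finset.sum_eq_zero fun i hi => ?_
  change ∀ᵐ x ∂_, x ∈ treePoints a n
  refine (ae_map_iff (p := (· ∈ treePoints a n)) (by fun_prop) (measurableSet_treePoints a n)).2 ?_
  exact (ae_restrict_mem measurableSet_Icc).mono fun s hs => ⟨Finset.mem_Icc.1 hi, hs⟩

lemma IsUniformPoint.ae_mem (hZ : IsUniformPoint P a Y n Z) : ∀ᵐ ω ∂P, Z ω ∈ treePoints a n :=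
  ae_of_ae_map hZ.1.aemeasurable (hZ.2.1 ▸ ae_uniformMeasure_mem a n)

lemma IsGluingSequence.ae_mem (hY : IsGluingSequence P a Y) :
    ∀ᵐ ω ∂P, ∀ k : ℕ, 1 ≤ k → Y k ω ∈ treePoints a k := by
  rw [ae_all_iff]
  intro k
  by_cases hk : 1 ≤ k
  · filter_upwards [(hY k hk).ae_mem] with ω hω _ using hω
  · exact Eventually.of_forall fun ω hk' => absurd hk' hk

lemma integral_uniformMeasure (ha : ∀ n : ℕ, 1 ≤ n → 0 < a n) {f : ℕ × ℝ → ℝ}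
    (hf : Measurable f)
    (hfi : ∀ i ∈ Finset.Icc 1 n, IntegrableOn (fun s => f (i, s)) (Set.Icc 0 (a i))) :
    ∫ x, f x ∂uniformMeasure a n =
      (totalLength a n)⁻¹ * ∑ i ∈ Finset.Icc 1 n, ∫ s in Set.Icc 0 (a i), f (i, s) := by
  have hA : 0 ≤ totalLength a n :=
    Finset.sum_nonneg fun i hi => (ha i (Finset.mem_Icc.1 hi).1).le
  unfold uniformMeasure
  rw [← totalLength, integral_smul_measure, integral_finsetSum_measure, ENNReal.toReal_inv,
    ENNReal.toReal_ofReal hA, smul_eq_mul]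
  · congr 1
    refine Finset.sum_congr rfl fun i _ => ?_
    rw [integral_map (by fun_prop) hf.aestronglyMeasurable]
  · intro i hi
    rw [integrable_map_measure hf.aestronglyMeasurable (by fun_prop)]
    exact hfi i hi

end UniformPoint

section PointHeight

variable {Ω : Type*} [MeasurableSpace Ω] {P : Measure Ω} {a : ℕ → ℝ} {Y X : ℕ → Ω → ℕ × ℝ} {n j : ℕ}

lemma setIntegral_exp_mul {θ r : ℝ} (hr : 0 < r) :
    ∫ s in Set.Icc 0 r, Real.exp (θ * s) = r * (1 + glueGain (θ * r)) := by
  rw [integral_Icc_eq_integral_Ioc, ← intervalIntegral.integral_of_le hr.le]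
  rcases eq_or_ne θ 0 with rfl | hθ
  · simp [glueGain]
  · rw [intervalIntegral.integral_comp_mul_left (fun x => Real.exp x) hθ, integral_exp]
    simp only [glueGain, mul_zero, Real.exp_zero, smul_eq_mul]
    field_simp
    ring

lemma measurable_ite_fst_eq_exp (j : ℕ) (θ : ℝ) :
    Measurable fun x : ℕ × ℝ => if x.1 = j then Real.exp (θ * x.2) else 0 :=
  Measurable.ite (measurable_fst (measurableSet_singleton j)) (by fun_prop) measurable_const

lemma IsUniformPoint.integral_ite_fst_eq_exp {Z : Ω → ℕ × ℝ} (hZ : IsUniformPoint P a Y n Z)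
    (ha : ∀ n : ℕ, 1 ≤ n → 0 < a n) (hj : j ∈ Finset.Icc 1 n) (θ : ℝ) :
    ∫ ω, (if (Z ω).1 = j then Real.exp (θ * (Z ω).2) else 0) ∂P =
      (totalLength a n)⁻¹ * (a j * (1 + glueGain (θ * a j))) := by
  have hmeas := measurable_ite_fst_eq_exp j θ
  rw [← integral_map (f := fun x : ℕ × ℝ => if x.1 = j then Real.exp (θ * x.2) else 0)
    hZ.1.aemeasurable hmeas.aestronglyMeasurable, hZ.2.1, integral_uniformMeasure ha hmeas]
  · rw [Finset.sum_eq_single_of_mem j hj fun i _ hij => by simp [hij]]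
    simp only [if_true, setIntegral_exp_mul (ha j (Finset.mem_Icc.1 hj).1)]
  · intro i _
    by_cases hij : i = j
    · simp only [hij, if_true]
      exact (by fun_prop : Continuous fun s : ℝ => Real.exp (θ * s)).continuousOn.integrableOn_Icc
    · simp [hij]

lemma sum_mul_heightMgf (ha : ∀ n : ℕ, 1 ≤ n → 0 < a n) (θ : ℝ) (n : ℕ) :
    ∑ j ∈ Finset.Icc 1 n, a j * (1 + glueGain (θ * a j)) * heightMgf a (j - 1) θ =
      totalLength a n * heightMgf a n θ := by
  induction n with
  | zero => simp [totalLength]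
  | succ n ih =>
    have hmgf : heightMgf a (n + 1) θ = heightMgf a n θ *
        (1 + a (n + 1) / totalLength a (n + 1) * glueGain (θ * a (n + 1))) :=
      Finset.prod_Icc_succ_top (by omega) _
    have hA := (totalLength_pos ha (show 1 ≤ n + 1 by omega)).ne'
    rw [Finset.sum_Icc_succ_top (by omega), ih, add_tsub_cancel_right, hmgf,
      eq_sub_of_add_eq (totalLength_succ a n).symm]
    field_simp
    ring

lemma measurable_pointHeight (hY : IsGluingSequence P a Y) (hX : Measurable (X n)) :
    Measurable (pointHeight Y X n) :=
  measurable_treeDist_root (fun _ hk => hY.measurable hk.1) hX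

lemma ae_pointHeight_mem_Icc (ha : ∀ n : ℕ, 1 ≤ n → 0 < a n) (hY : IsGluingSequence P a Y)
    (hX : IsUniformPoint P a Y n (X n)) :
    ∀ᵐ ω ∂P, pointHeight Y X n ω ∈ Set.Icc 0 (totalLength a n) := by
  filter_upwards [hY.ae_mem, hX.ae_mem] with ω hYω hXω using treeDist_root_mem_Icc ha hYω hXω

lemma integrable_comp_of_ae_mem [IsFiniteMeasure P] {f : Ω → ℝ} (hf : Measurable f) {φ : ℝ → ℝ}
    (hφ : Measurable φ) {s : Set ℝ} {C : ℝ} (hfs : ∀ᵐ ω ∂P, f ω ∈ s) (hφC : ∀ x ∈ s, |φ x| ≤ C) :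
    Integrable (fun ω => φ (f ω)) P :=
  Integrable.of_bound (hφ.comp hf).aestronglyMeasurable C (hfs.mono fun _ hω => hφC _ hω)

lemma abs_exp_mul_le {θ A x : ℝ} (hx : x ∈ Set.Icc 0 A) :
    |Real.exp (θ * x)| ≤ Real.exp (|θ| * A) := by
  rw [Real.abs_exp]
  refine Real.exp_le_exp.2 ?_
  calc θ * x ≤ |θ| * x := mul_le_mul_of_nonneg_right (le_abs_self θ) hx.1
    _ ≤ |θ| * A := mul_le_mul_of_nonneg_left hx.2 (abs_nonneg θ)

lemma integrable_exp_pointHeight [IsFiniteMeasure P] (ha : ∀ n : ℕ, 1 ≤ n → 0 < a n)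
    (hY : IsGluingSequence P a Y) (hX : IsUniformPoint P a Y n (X n)) (θ : ℝ) :
    Integrable (fun ω => Real.exp (θ * pointHeight Y X n ω)) P :=
  integrable_comp_of_ae_mem (φ := fun x => Real.exp (θ * x)) (measurable_pointHeight hY hX.1)
    (by fun_prop) (ae_pointHeight_mem_Icc ha hY hX) fun _ hx => abs_exp_mul_le hx

lemma exp_pointHeight_ae_eq_sum (hX : IsUniformPoint P a Y n (X n)) (θ : ℝ) :
    (fun ω => Real.exp (θ * pointHeight Y X n ω)) =ᵐ[P] fun ω =>
      ∑ j ∈ Finset.Icc 1 n, (if (X n ω).1 = j then Real.exp (θ * (X n ω).2) else 0) *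
        Real.exp (θ * baseHeight (fun k => Y k ω) j) := by
  filter_upwards [hX.ae_mem] with ω hω
  rw [Finset.sum_eq_single_of_mem (X n ω).1 (Finset.mem_Icc.2 hω.1), if_pos rfl, ← Real.exp_add,
    ← mul_add, pointHeight, treeDist_root_of_mem _ hω]
  intro j _ hj
  rw [if_neg hj.symm, zero_mul]

lemma measurable_exp_baseHeight (θ : ℝ) (j : ℕ) :
    Measurable fun g : ℕ → ℕ × ℝ => Real.exp (θ * baseHeight g j) :=
  Real.measurable_exp.comp ((measurable_baseHeight j).const_mul θ)

lemma dependsOn_exp_baseHeight (θ : ℝ) (hjn : j ≤ n) :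
    DependsOn (fun g => Real.exp (θ * baseHeight g j)) (Set.Ico 1 n) := fun _ _ hgg' =>
  congrArg (fun x => Real.exp (θ * x))
    ((dependsOn_baseHeight j).mono (Set.Ico_subset_Ico_right hjn) hgg')

/-- The segment on which a uniform point lies is independent of the height of its base. -/
lemma integral_exp_pointHeight_eq_sum [IsFiniteMeasure P] (ha : ∀ n : ℕ, 1 ≤ n → 0 < a n)
    (hY : IsGluingSequence P a Y) (hX : IsUniformPoint P a Y n (X n)) (θ : ℝ) :
    ∫ ω, Real.exp (θ * pointHeight Y X n ω) ∂P = (totalLength a n)⁻¹ *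
      ∑ j ∈ Finset.Icc 1 n, a j * (1 + glueGain (θ * a j)) *
        ∫ ω, Real.exp (θ * baseHeight (fun k => Y k ω) j) ∂P := by
  have hmeas {j : ℕ} (hj : j ∈ Finset.Icc 1 n) :=
    hY.measurable_comp (measurable_exp_baseHeight θ j)
      (dependsOn_exp_baseHeight θ (Finset.mem_Icc.1 hj).2)
  rw [integral_congr_ae (exp_pointHeight_ae_eq_sum hX θ), integral_finsetSum, Finset.mul_sum]
  · refine Finset.sum_congr rfl fun j hj => ?_
    rw [(hX.indepFun_comp (measurable_ite_fst_eq_exp j θ) (measurable_exp_baseHeight θ j)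
        (dependsOn_exp_baseHeight θ (Finset.mem_Icc.1 hj).2)).integral_fun_mul_eq_mul_integral
      ((measurable_ite_fst_eq_exp j θ).comp hX.1).aestronglyMeasurable
      (hmeas hj).aestronglyMeasurable, hX.integral_ite_fst_eq_exp ha hj]
    ring
  · intro j hj
    refine Integrable.of_bound (((measurable_ite_fst_eq_exp j θ).comp hX.1).mul
      (hmeas hj)).aestronglyMeasurable
      (Real.exp (|θ| * a j) * Real.exp (|θ| * totalLength a (j - 1))) ?_
    filter_upwards [hY.ae_mem, hX.ae_mem] with ω hYω hXω
    rw [norm_mul]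
    gcongr
    · split_ifs with hfst
      · exact abs_exp_mul_le (hfst ▸ hXω.2)
      · simpa using (Real.exp_pos _).le
    · exact abs_exp_mul_le (baseHeight_mem_Icc ha hYω (Finset.mem_Icc.1 hj).1)

theorem integral_exp_pointHeight [IsProbabilityMeasure P] (ha : ∀ n : ℕ, 1 ≤ n → 0 < a n)
    (hY : IsGluingSequence P a Y) (hn : 1 ≤ n) (hX : IsUniformPoint P a Y n (X n)) (θ : ℝ) :
    ∫ ω, Real.exp (θ * pointHeight Y X n ω) ∂P = heightMgf a n θ := by
  induction n using Nat.strong_induction_on generalizing X with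
  | _ n ih =>
    have hbase : ∀ j ∈ Finset.Icc 1 n,
        ∫ ω, Real.exp (θ * baseHeight (fun k => Y k ω) j) ∂P = heightMgf a (j - 1) θ := by
      intro j hj
      obtain ⟨hj₁, hjn⟩ := Finset.mem_Icc.1 hj
      obtain ⟨k, rfl⟩ : ∃ k, j = k + 1 := ⟨j - 1, by omega⟩
      rcases Nat.eq_zero_or_pos k with rfl | hk
      · simp [heightMgf]
      · simp only [add_tsub_cancel_right, ← ih k (by omega) hk (hY k hk), baseHeight_succ _ hk,
          pointHeight]
    rw [integral_exp_pointHeight_eq_sum ha hY hX,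
      Finset.sum_congr rfl fun j hj => by rw [hbase j hj], sum_mul_heightMgf ha,
      inv_mul_cancel_left₀ (totalLength_pos ha hn).ne']

end PointHeight

/-! ### Weak convergence from Laplace transforms -/

lemma isTightMeasureSet_of_integral_norm_le {E : Type*} [NormedAddCommGroup E] [ProperSpace E]
    [MeasurableSpace E] {S : Set (Measure E)} {C : ℝ} (hfin : ∀ μ ∈ S, IsFiniteMeasure μ)
    (hint : ∀ μ ∈ S, Integrable (fun x => ‖x‖) μ) (hC : ∀ μ ∈ S, ∫ x, ‖x‖ ∂μ ≤ C) :
    IsTightMeasureSet S := by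
  refine isTightMeasureSet_of_tendsto_measure_norm_gt ?_
  have hlim : Tendsto (fun r : ℝ => ENNReal.ofReal (C / r)) atTop (𝓝 0) := by
    simpa only [ENNReal.ofReal_zero, id] using
      ENNReal.tendsto_ofReal (tendsto_id.const_div_atTop C)
  refine tendsto_of_tendsto_of_tendsto_of_le_of_le' tendsto_const_nhds hlim
    (Eventually.of_forall fun _ => zero_le) ?_
  filter_upwards [eventually_gt_atTop 0] with r hr
  refine iSup₂_le fun μ hμ => ?_
  have := hfin μ hμ
  calc μ {x | r < ‖x‖} ≤ μ {x | r ≤ ‖x‖} := measure_mono fun x (hx : r < ‖x‖) => hx.le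
    _ = ENNReal.ofReal (μ.real {x | r ≤ ‖x‖}) := by rw [ofReal_measureReal]
    _ ≤ ENNReal.ofReal (C / r) := by
        refine ENNReal.ofReal_le_ofReal ((le_div_iff₀' hr).2 (le_trans ?_ (hC μ hμ)))
        exact mul_meas_ge_le_integral_of_nonneg (ae_of_all _ fun x => norm_nonneg x) (hint μ hμ) r

lemma abs_sub_clamp_le {K : ℝ} (hK : 0 < K) (x : ℝ) : |x - max (-K) (min x K)| ≤ x ^ 2 / K := by
  rw [le_div_iff₀ hK]
  rcases le_total x K with hxK | hxK
  · rw [min_eq_left hxK]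
    rcases le_total (-K) x with hKx | hKx
    · rw [max_eq_right hKx, sub_self, abs_zero, zero_mul]
      exact sq_nonneg x
    · rw [max_eq_left hKx, abs_of_nonpos (by linarith)]
      nlinarith [sq_nonneg (x + K)]
  · rw [min_eq_right hxK, max_eq_right (by linarith), abs_of_nonneg (by linarith)]
    nlinarith [sq_nonneg (x - K)]

lemma abs_clamp_le {K : ℝ} (hK : 0 ≤ K) (x : ℝ) : |max (-K) (min x K)| ≤ K :=
  abs_le.2 ⟨le_max_left _ _, max_le (by linarith) (min_le_right _ _)⟩

section WeakConvergence

variable {E : Type*} [TopologicalSpace E] [MeasurableSpace E] [OpensMeasurableSpace E] {f : E → ℝ}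

lemma integrable_clamp {μ : Measure E} [IsFiniteMeasure μ] (hf : Continuous f) {K : ℝ}
    (hK : 0 ≤ K) : Integrable (fun x => max (-K) (min (f x) K)) μ :=
  Integrable.of_bound (by fun_prop : Continuous _).aestronglyMeasurable K
    (ae_of_all _ fun x => abs_clamp_le hK (f x))

lemma abs_integral_sub_integral_clamp_le {μ : Measure E} [IsFiniteMeasure μ] (hf : Continuous f)
    (hsq : Integrable (fun x => f x ^ 2) μ) {C K : ℝ} (hC : ∫ x, f x ^ 2 ∂μ ≤ C) (hK : 0 < K) :
    |∫ x, f x ∂μ - ∫ x, max (-K) (min (f x) K) ∂μ| ≤ C / K := by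
  have hfi : Integrable f μ :=
    ((memLp_two_iff_integrable_sq hf.aestronglyMeasurable).2 hsq).integrable one_le_two
  rw [← integral_sub hfi (integrable_clamp hf hK.le)]
  calc |∫ x, (f x - max (-K) (min (f x) K)) ∂μ|
      ≤ ∫ x, |f x - max (-K) (min (f x) K)| ∂μ := abs_integral_le_integral_abs
    _ ≤ ∫ x, f x ^ 2 / K ∂μ :=
        integral_mono (hfi.sub (integrable_clamp hf hK.le)).abs (hsq.div_const K) fun x =>
          abs_sub_clamp_le hK (f x)
    _ ≤ C / K := by rw [integral_div]; gcongr

variable {μs : ℕ → ProbabilityMeasure E} {μ : ProbabilityMeasure E}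

lemma tendsto_integral_clamp (h : Tendsto μs atTop (𝓝 μ)) (hf : Continuous f) {K : ℝ}
    (hK : 0 ≤ K) :
    Tendsto (fun n => ∫ x, max (-K) (min (f x) K) ∂(μs n : Measure E)) atTop
      (𝓝 (∫ x, max (-K) (min (f x) K) ∂(μ : Measure E))) :=
  ProbabilityMeasure.tendsto_iff_forall_integral_tendsto.1 h
    (BoundedContinuousFunction.ofNormedAddCommGroup (fun x => max (-K) (min (f x) K))
      (by fun_prop) K fun x => abs_clamp_le hK (f x))

variable [HasOuterApproxClosed E]

lemma integrable_of_tendsto_of_integral_le (h : Tendsto μs atTop (𝓝 μ)) (hf : Continuous f)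
    (hf₀ : 0 ≤ f) (hint : ∀ n, Integrable f (μs n : Measure E)) {C : ℝ}
    (hC : ∀ n, ∫ x, f x ∂(μs n : Measure E) ≤ C) :
    Integrable f (μ : Measure E) ∧ ∫ x, f x ∂(μ : Measure E) ≤ C := by
  have hfatou : ∫⁻ x, ENNReal.ofReal (f x) ∂(μ : Measure E) ≤ ENNReal.ofReal C := by
    refine (lintegral_le_liminf_lintegral_of_forall_isOpen_measure_le_liminf_measure hf hf₀
      fun G hG => ProbabilityMeasure.le_liminf_measure_open_of_tendsto h hG).trans ?_
    refine liminf_le_of_frequently_le' (Frequently.of_forall fun n => ?_)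
    rw [← ofReal_integral_eq_lintegral_ofReal (hint n) (ae_of_all _ hf₀)]
    exact ENNReal.ofReal_le_ofReal (hC n)
  refine ⟨⟨hf.aestronglyMeasurable, ?_⟩, ?_⟩
  · rw [hasFiniteIntegral_iff_ofReal (ae_of_all _ hf₀)]
    exact hfatou.trans_lt ENNReal.ofReal_lt_top
  · rw [integral_eq_lintegral_of_nonneg_ae (ae_of_all _ hf₀) hf.aestronglyMeasurable]
    exact ENNReal.toReal_le_of_le_ofReal ((integral_nonneg hf₀).trans (hC 0)) hfatou

theorem tendsto_integral_of_integral_sq_le (h : Tendsto μs atTop (𝓝 μ)) (hf : Continuous f)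
    (hint : ∀ n, Integrable (fun x => f x ^ 2) (μs n : Measure E)) {C : ℝ}
    (hC : ∀ n, ∫ x, f x ^ 2 ∂(μs n : Measure E) ≤ C) :
    Integrable f (μ : Measure E) ∧
      Tendsto (fun n => ∫ x, f x ∂(μs n : Measure E)) atTop (𝓝 (∫ x, f x ∂(μ : Measure E))) := by
  obtain ⟨hμsq, hμC⟩ := integrable_of_tendsto_of_integral_le h (hf.pow 2)
    (fun x => sq_nonneg (f x)) hint hC
  refine ⟨((memLp_two_iff_integrable_sq hf.aestronglyMeasurable).2 hμsq).integrable one_le_two, ?_⟩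
  rw [Metric.tendsto_nhds]
  intro ε hε
  obtain ⟨K, hCK, hK⟩ : ∃ K : ℝ, C / K < ε / 3 ∧ 0 < K :=
    (((tendsto_id.const_div_atTop C).eventually (gt_mem_nhds (by positivity : 0 < ε / 3))).and
      (eventually_gt_atTop 0)).exists
  have htail := abs_integral_sub_integral_clamp_le hf hμsq hμC hK
  filter_upwards [Metric.tendsto_nhds.1 (tendsto_integral_clamp h hf hK.le) (ε / 3)
    (by positivity)] with n hn
  have htail_n := abs_integral_sub_integral_clamp_le hf (hint n) (hC n) hK
  rw [Real.dist_eq, abs_lt] at hn ⊢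
  rw [abs_le] at htail htail_n
  constructor <;> linarith

end WeakConvergence

lemma eq_of_integral_exp_eq {μ ν : ProbabilityMeasure ℝ}
    (hint : ∀ t : ℝ, Integrable (fun x => Real.exp (t * x)) (μ : Measure ℝ))
    (h : ∀ t : ℝ, ∫ x, Real.exp (t * x) ∂(μ : Measure ℝ) = ∫ x, Real.exp (t * x) ∂(ν : Measure ℝ)) :
    μ = ν := by
  have huniv : integrableExpSet id (μ : Measure ℝ) = Set.univ := Set.eq_univ_of_forall hint
  have hmgf : mgf id (μ : Measure ℝ) = mgf id (ν : Measure ℝ) := funext h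
  have hext : (μ : Measure ℝ) = ν := Measure.ext_of_complexMGF_id_eq
    (funext fun z => eqOn_complexMGF_of_mgf hmgf (by simp [huniv]))
  exact Subtype.ext hext

lemma IsXiLaw.eq {α : ℝ} {ν ν' : ProbabilityMeasure ℝ} (hν : IsXiLaw α ν) (hν' : IsXiLaw α ν') :
    ν = ν' :=
  eq_of_integral_exp_eq (fun t => (hν t).1) fun t => (hν t).2.trans (hν' t).2.symm

section LaplaceTransform

variable {μs : ℕ → ProbabilityMeasure ℝ} {ν : ProbabilityMeasure ℝ} {M : ℝ → ℝ}

lemma tendsto_integral_exp_of_tendsto (hν : Tendsto μs atTop (𝓝 ν))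
    (hint : ∀ n t, Integrable (fun x => Real.exp (t * x)) (μs n : Measure ℝ))
    (hlim : ∀ t, Tendsto (fun n => ∫ x, Real.exp (t * x) ∂(μs n : Measure ℝ)) atTop (𝓝 (M t)))
    (t : ℝ) :
    Integrable (fun x => Real.exp (t * x)) (ν : Measure ℝ) ∧
      ∫ x, Real.exp (t * x) ∂(ν : Measure ℝ) = M t := by
  have hsq (x : ℝ) : Real.exp (t * x) ^ 2 = Real.exp (2 * t * x) := by
    rw [← Real.exp_nat_mul, Nat.cast_ofNat, mul_assoc]
  obtain ⟨C, hC⟩ := (hlim (2 * t)).bddAbove_range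
  obtain ⟨hνint, hνlim⟩ := tendsto_integral_of_integral_sq_le hν
    (f := fun x => Real.exp (t * x)) (by fun_prop) (C := C)
    (fun n => by simpa only [hsq] using hint n (2 * t))
    (fun n => by simpa only [hsq] using hC ⟨n, rfl⟩)
  exact ⟨hνint, tendsto_nhds_unique hνlim (hlim t)⟩

lemma exists_forall_integral_abs_rpow_le
    (hint : ∀ n t, Integrable (fun x => Real.exp (t * x)) (μs n : Measure ℝ))
    (hlim : ∀ t, Tendsto (fun n => ∫ x, Real.exp (t * x) ∂(μs n : Measure ℝ)) atTop (𝓝 (M t)))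
    {p : ℝ} (hp : 0 ≤ p) :
    (∀ n, Integrable (fun x => |x| ^ p) (μs n : Measure ℝ)) ∧
      ∃ C : ℝ, ∀ n, ∫ x, |x| ^ p ∂(μs n : Measure ℝ) ≤ C := by
  have habs (n : ℕ) : Integrable (fun x => |x| ^ p) (μs n : Measure ℝ) :=
    integrable_rpow_abs_of_integrable_exp_mul (X := id) one_ne_zero (hint n 1) (hint n (-1)) hp
  obtain ⟨C, hC⟩ := (((hlim 1).add (hlim (-1))).const_mul (p ^ p)).bddAbove_range
  refine ⟨habs, C, fun n => le_trans ?_ (hC ⟨n, rfl⟩)⟩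
  simp only [← integral_add (hint n 1) (hint n (-1)), ← integral_const_mul]
  refine integral_mono (habs n) (((hint n 1).add (hint n (-1))).const_mul _) fun x => ?_
  have hbound := rpow_abs_le_mul_max_exp x hp one_ne_zero
  rw [abs_one, div_one] at hbound
  exact hbound.trans (mul_le_mul_of_nonneg_left
    (max_le_add_of_nonneg (Real.exp_pos _).le (Real.exp_pos _).le) (Real.rpow_nonneg hp p))

theorem exists_tendsto_of_tendsto_integral_exp
    (hint : ∀ n t, Integrable (fun x => Real.exp (t * x)) (μs n : Measure ℝ))
    (hlim : ∀ t, Tendsto (fun n => ∫ x, Real.exp (t * x) ∂(μs n : Measure ℝ)) atTop (𝓝 (M t))) :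
    ∃ ν : ProbabilityMeasure ℝ, (∀ t, Integrable (fun x => Real.exp (t * x)) (ν : Measure ℝ) ∧
      ∫ x, Real.exp (t * x) ∂(ν : Measure ℝ) = M t) ∧ Tendsto μs atTop (𝓝 ν) := by
  obtain ⟨habs, C, hC⟩ := exists_forall_integral_abs_rpow_le hint hlim zero_le_one
  simp only [Real.rpow_one] at habs hC
  have hcompact : IsCompact (closure (Set.range μs)) := by
    refine isCompact_closure_of_isTightMeasureSet
      (isTightMeasureSet_of_integral_norm_le (C := C) ?_ ?_ ?_) <;>
      rintro _ ⟨_, ⟨n, rfl⟩, rfl⟩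
    exacts [inferInstance, habs n, hC n]
  have hsubseq (ns : ℕ → ℕ) (hns : Tendsto ns atTop atTop) :
      ∃ ν : ProbabilityMeasure ℝ, (∀ t, Integrable (fun x => Real.exp (t * x)) (ν : Measure ℝ) ∧
        ∫ x, Real.exp (t * x) ∂(ν : Measure ℝ) = M t) ∧
        ∃ ms : ℕ → ℕ, Tendsto (fun n => μs (ns (ms n))) atTop (𝓝 ν) := by
    obtain ⟨ν, -, ms, hms, hν⟩ := hcompact.tendsto_subseq (x := μs ∘ ns)
      fun n => subset_closure ⟨ns n, rfl⟩
    exact ⟨ν, tendsto_integral_exp_of_tendsto hν (fun _ => hint _) fun t =>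
      (hlim t).comp (hns.comp hms.tendsto_atTop), ms, hν⟩
  obtain ⟨ν, hνM, -⟩ := hsubseq id tendsto_id
  refine ⟨ν, hνM, tendsto_of_subseq_tendsto fun ns hns => ?_⟩
  obtain ⟨ν', hνM', ms, hms⟩ := hsubseq ns hns
  obtain rfl : ν = ν' := eq_of_integral_exp_eq (fun t => (hνM t).1) fun t =>
    (hνM t).2.trans (hνM' t).2.symm
  exact ⟨ms, hms⟩

theorem tendsto_integral_rpow_of_tendsto (hν : Tendsto μs atTop (𝓝 ν))
    (hint : ∀ n t, Integrable (fun x => Real.exp (t * x)) (μs n : Measure ℝ))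
    (hlim : ∀ t, Tendsto (fun n => ∫ x, Real.exp (t * x) ∂(μs n : Measure ℝ)) atTop (𝓝 (M t)))
    {p : ℝ} (hp : 0 ≤ p) :
    Tendsto (fun n => ∫ x, x ^ p ∂(μs n : Measure ℝ)) atTop (𝓝 (∫ x, x ^ p ∂(ν : Measure ℝ))) := by
  have hcont : Continuous fun x : ℝ => x ^ p := Real.continuous_rpow_const hp
  obtain ⟨habs, C, hC⟩ := exists_forall_integral_abs_rpow_le hint hlim
    (mul_nonneg zero_le_two hp)
  have hsq (x : ℝ) : (x ^ p) ^ 2 ≤ |x| ^ (2 * p) := by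
    rw [mul_comm, Real.rpow_mul (abs_nonneg x), Real.rpow_ofNat]
    exact sq_le_sq' (neg_le_of_abs_le (Real.abs_rpow_le_abs_rpow x p))
      (le_of_abs_le (Real.abs_rpow_le_abs_rpow x p))
  have hint_sq (n : ℕ) : Integrable (fun x : ℝ => (x ^ p) ^ 2) (μs n : Measure ℝ) :=
    (habs n).mono' (hcont.pow 2).aestronglyMeasurable (ae_of_all _ fun x => by
      rw [Real.norm_of_nonneg (sq_nonneg _)]
      exact hsq x)
  exact (tendsto_integral_of_integral_sq_le hν hcont hint_sq fun n =>
    (integral_mono (hint_sq n) (habs n) hsq).trans (hC n)).2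

end LaplaceTransform

/-! ### The height of a uniform point -/

section RescaledHeight

variable {Ω : Type*} [MeasurableSpace Ω] {P : Measure Ω} {a : ℕ → ℝ} {α : ℝ}
  {Y X : ℕ → Ω → ℕ × ℝ}

lemma measurable_pointHeight_div (hY : IsGluingSequence P a Y)
    (hX : ∀ n : ℕ, 1 ≤ n → IsUniformPoint P a Y n (X n)) (n : ℕ) :
    Measurable fun ω => pointHeight Y X n ω / a n := by
  rcases Nat.eq_zero_or_pos n with rfl | hn
  · simp only [pointHeight, treeDist, zero_div]
    exact measurable_const
  · exact (measurable_pointHeight hY (hX n hn).1).div_const _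

variable [IsProbabilityMeasure P]

lemma integrable_exp_pointHeight_div (ha : ∀ n : ℕ, 1 ≤ n → 0 < a n) (hY : IsGluingSequence P a Y)
    (hX : ∀ n : ℕ, 1 ≤ n → IsUniformPoint P a Y n (X n)) (n : ℕ) (lam : ℝ) :
    Integrable (fun ω => Real.exp (lam * (pointHeight Y X n ω / a n))) P := by
  rcases Nat.eq_zero_or_pos n with rfl | hn
  · simp only [pointHeight, treeDist]
    exact integrable_const _
  · simpa only [mul_div_assoc, div_mul_eq_mul_div] using
      integrable_exp_pointHeight ha hY (hX n hn) (lam / a n)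

lemma integrable_rpow_pointHeight_div (ha : ∀ n : ℕ, 1 ≤ n → 0 < a n)
    (hY : IsGluingSequence P a Y) (hX : ∀ n : ℕ, 1 ≤ n → IsUniformPoint P a Y n (X n)) (n : ℕ)
    {p : ℝ} (hp : 0 ≤ p) : Integrable (fun ω => (pointHeight Y X n ω / a n) ^ p) P :=
  integrable_rpow_of_integrable_exp_mul one_ne_zero (integrable_exp_pointHeight_div ha hY hX n 1)
    (integrable_exp_pointHeight_div ha hY hX n (-1)) hp

lemma PotterBounds.tendsto_integral_exp_pointHeight_div (h : PotterBounds a α) (hα : 0 < α)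
    (hY : IsGluingSequence P a Y) (hX : ∀ n : ℕ, 1 ≤ n → IsUniformPoint P a Y n (X n)) (lam : ℝ) :
    Tendsto (fun n => ∫ ω, Real.exp (lam * (pointHeight Y X n ω / a n)) ∂P) atTop
      (𝓝 (Real.exp (phi α lam))) := by
  refine (h.tendsto_heightMgf hα lam).congr' ?_
  filter_upwards [eventually_ge_atTop 1] with n hn
  rw [← integral_exp_pointHeight h.pos hY hn (hX n hn)]
  simp only [mul_div_assoc, div_mul_eq_mul_div]

/-- The law of `D n / a n`. -/
noncomputable def rescaledHeightLaw (hY : IsGluingSequence P a Y)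
    (hX : ∀ n : ℕ, 1 ≤ n → IsUniformPoint P a Y n (X n)) (n : ℕ) : ProbabilityMeasure ℝ :=
  ⟨P.map fun ω => pointHeight Y X n ω / a n,
    Measure.isProbabilityMeasure_map (measurable_pointHeight_div hY hX n).aemeasurable⟩

lemma integral_rescaledHeightLaw (hY : IsGluingSequence P a Y)
    (hX : ∀ n : ℕ, 1 ≤ n → IsUniformPoint P a Y n (X n)) (n : ℕ) {f : ℝ → ℝ} (hf : Measurable f) :
    ∫ x, f x ∂(rescaledHeightLaw hY hX n : Measure ℝ) = ∫ ω, f (pointHeight Y X n ω / a n) ∂P :=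
  integral_map (measurable_pointHeight_div hY hX n).aemeasurable hf.aestronglyMeasurable

lemma integrable_exp_rescaledHeightLaw (ha : ∀ n : ℕ, 1 ≤ n → 0 < a n)
    (hY : IsGluingSequence P a Y) (hX : ∀ n : ℕ, 1 ≤ n → IsUniformPoint P a Y n (X n)) (n : ℕ)
    (lam : ℝ) : Integrable (fun x => Real.exp (lam * x)) (rescaledHeightLaw hY hX n : Measure ℝ) :=
  (integrable_map_measure (by fun_prop) (measurable_pointHeight_div hY hX n).aemeasurable).2
    (integrable_exp_pointHeight_div ha hY hX n lam)

lemma PotterBounds.tendsto_integral_exp_rescaledHeightLaw (h : PotterBounds a α) (hα : 0 < α)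
    (hY : IsGluingSequence P a Y) (hX : ∀ n : ℕ, 1 ≤ n → IsUniformPoint P a Y n (X n)) (lam : ℝ) :
    Tendsto (fun n => ∫ x, Real.exp (lam * x) ∂(rescaledHeightLaw hY hX n : Measure ℝ)) atTop
      (𝓝 (Real.exp (phi α lam))) :=
  (h.tendsto_integral_exp_pointHeight_div hα hY hX lam).congr fun n =>
    (integral_rescaledHeightLaw hY hX n (f := fun x => Real.exp (lam * x)) (by fun_prop)).symm

theorem PotterBounds.existsUnique_isXiLaw (h : PotterBounds a α) (hα : 0 < α)
    (hY : IsGluingSequence P a Y) : ∃! ν : ProbabilityMeasure ℝ, IsXiLaw α ν := by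
  obtain ⟨ν, hν, -⟩ := exists_tendsto_of_tendsto_integral_exp
    (integrable_exp_rescaledHeightLaw h.pos hY hY)
    (h.tendsto_integral_exp_rescaledHeightLaw hα hY hY)
  exact ⟨ν, hν, fun ν' hν' => IsXiLaw.eq hν' hν⟩

theorem PotterBounds.tendsto_rescaledHeightLaw (h : PotterBounds a α) (hα : 0 < α)
    (hY : IsGluingSequence P a Y) (hX : ∀ n : ℕ, 1 ≤ n → IsUniformPoint P a Y n (X n))
    {ν : ProbabilityMeasure ℝ} (hν : IsXiLaw α ν) :
    Tendsto (rescaledHeightLaw hY hX) atTop (𝓝 ν) := by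
  obtain ⟨ν', hν', hlim⟩ := exists_tendsto_of_tendsto_integral_exp
    (integrable_exp_rescaledHeightLaw h.pos hY hX)
    (h.tendsto_integral_exp_rescaledHeightLaw hα hY hX)
  rwa [hν.eq hν']

theorem PotterBounds.tendstoInDistribution_pointHeight_div (h : PotterBounds a α) (hα : 0 < α)
    (hY : IsGluingSequence P a Y) (hX : ∀ n : ℕ, 1 ≤ n → IsUniformPoint P a Y n (X n))
    {ν : ProbabilityMeasure ℝ} (hν : IsXiLaw α ν) :
    TendstoInDistribution (fun n ω => pointHeight Y X n ω / a n) atTop (id : ℝ → ℝ) (fun _ => P)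
      (ν : Measure ℝ) where
  forall_aemeasurable n := (measurable_pointHeight_div hY hX n).aemeasurable
  tendsto := by
    simp only [Measure.map_id]
    exact h.tendsto_rescaledHeightLaw hα hY hX hν

theorem PotterBounds.tendsto_integral_rpow_pointHeight_div (h : PotterBounds a α) (hα : 0 < α)
    (hY : IsGluingSequence P a Y) (hX : ∀ n : ℕ, 1 ≤ n → IsUniformPoint P a Y n (X n))
    {ν : ProbabilityMeasure ℝ} (hν : IsXiLaw α ν) {p : ℝ} (hp : 0 ≤ p) :
    Tendsto (fun n : ℕ => ∫ ω, (pointHeight Y X n ω / a n) ^ p ∂P) atTop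
      (𝓝 (∫ x : ℝ, x ^ p ∂(ν : Measure ℝ))) :=
  (tendsto_integral_rpow_of_tendsto (h.tendsto_rescaledHeightLaw hα hY hX hν)
    (integrable_exp_rescaledHeightLaw h.pos hY hX)
    (h.tendsto_integral_exp_rescaledHeightLaw hα hY hX) hp).congr fun n =>
      integral_rescaledHeightLaw hY hX n (f := fun x => x ^ p) (by fun_prop)

end RescaledHeight

/-! ### The upper bound for the height of the tree -/

/-- The order of magnitude `ln x / ln ln x` of the ratio between the height of `T n` and `a n`, at
`x = n`. It is meaningful for `x > e` only. -/
noncomputable def logRatio (x : ℝ) : ℝ := Real.log x / Real.log (Real.log x)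

lemma tendsto_log_log_atTop : Tendsto (fun x : ℝ => Real.log (Real.log x)) atTop atTop :=
  Real.tendsto_log_atTop.comp Real.tendsto_log_atTop

lemma tendsto_logRatio_atTop : Tendsto logRatio atTop atTop := by
  have hlim : Tendsto (fun y : ℝ => Real.log y / y) atTop (𝓝[>] 0) := by
    refine tendsto_nhdsWithin_iff.2 ⟨by
      simpa only [id] using Real.isLittleO_log_id_atTop.tendsto_div_nhds_zero, ?_⟩
    filter_upwards [eventually_gt_atTop 1] with y hy
    exact div_pos (Real.log_pos hy) (by linarith)
  refine (hlim.inv_tendsto_nhdsGT_zero.comp Real.tendsto_log_atTop).congr fun x => ?_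
  simp only [Function.comp_apply, Pi.inv_apply, inv_div, logRatio]

lemma monotoneOn_logRatio : MonotoneOn logRatio (Set.Ici (Real.exp (Real.exp 1))) := by
  intro x hx y hy hxy
  have exp_le_log {z : ℝ} (hz : Real.exp (Real.exp 1) ≤ z) : Real.exp 1 ≤ Real.log z :=
    (Real.le_log_iff_exp_le ((Real.exp_pos _).trans_le hz)).2 hz
  have loglog_pos {z : ℝ} (hz : Real.exp (Real.exp 1) ≤ z) : 0 < Real.log (Real.log z) :=
    Real.log_pos ((Real.one_lt_exp_iff.2 one_pos).trans_le (exp_le_log hz))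
  have log_pos {z : ℝ} (hz : Real.exp (Real.exp 1) ≤ z) : 0 < Real.log z :=
    (Real.exp_pos 1).trans_le (exp_le_log hz)
  have hanti : Real.log (Real.log y) / Real.log y ≤ Real.log (Real.log x) / Real.log x :=
    Real.log_div_self_antitoneOn (exp_le_log hx) (exp_le_log hy)
      (Real.log_le_log ((Real.exp_pos _).trans_le hx) hxy)
  rw [div_le_div_iff₀ (log_pos hy) (log_pos hx)] at hanti
  rw [logRatio, logRatio, div_le_div_iff₀ (loglog_pos hx) (loglog_pos hy)]
  linarith

lemma eventually_log_mul_rpow_le {s c : ℝ} (hs : s < 1) (hc : 0 < c) :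
    ∀ᶠ x : ℝ in atTop, Real.log x * x ^ s ≤ c * x := by
  filter_upwards [(isLittleO_log_rpow_atTop (sub_pos.2 hs)).bound hc, eventually_gt_atTop 0]
    with x hlog hx
  rw [Real.norm_of_nonneg (Real.rpow_nonneg hx.le _)] at hlog
  calc Real.log x * x ^ s ≤ c * x ^ (1 - s) * x ^ s := by
        gcongr
        exact (Real.le_norm_self _).trans hlog
    _ = c * x := by rw [mul_assoc, ← Real.rpow_add hx, sub_add_cancel, Real.rpow_one]

lemma ae_eventually_notMem_of_le {Ω : Type*} [MeasurableSpace Ω] {P : Measure Ω}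
    [IsFiniteMeasure P] {s : ℕ → Set Ω} {u : ℕ → ℝ} (hu : Summable u)
    (h : ∀ᶠ n in atTop, P.real (s n) ≤ u n) : ∀ᵐ ω ∂P, ∀ᶠ n in atTop, ω ∉ s n := by
  have hs : Summable fun n => P.real (s n) := by
    refine Summable.of_norm_bounded_eventually_nat hu ?_
    filter_upwards [h] with n hn
    rwa [Real.norm_of_nonneg measureReal_nonneg]
  refine ae_eventually_notMem ?_
  simpa only [ofReal_measureReal (measure_ne_top _ _)] using hs.tsum_ofReal_ne_top

section TreeHeight

variable {Ω : Type*} {a : ℕ → ℝ} {α : ℝ} {Y : ℕ → Ω → ℕ × ℝ} {ω : Ω} {n : ℕ}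

lemma treeHeight_le (ha : ∀ n : ℕ, 1 ≤ n → 0 < a n) (hn : 1 ≤ n) {B : ℝ}
    (hB : ∀ j : ℕ, 1 ≤ j → j ≤ n → a j + baseHeight (fun k => Y k ω) j ≤ B) :
    treeHeight a Y n ω ≤ B := by
  refine csSup_le ⟨_, root, ⟨⟨le_rfl, hn⟩, le_rfl, (ha 1 le_rfl).le⟩, rfl⟩ ?_
  rintro _ ⟨x, hx, rfl⟩
  simp only [treeDist_root_of_mem _ hx]
  linarith [hB x.1 hx.1.1 hx.1.2, hx.2.2]

lemma baseHeight_le_treeHeight (ha : ∀ n : ℕ, 1 ≤ n → 0 < a n)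
    (hYω : ∀ k : ℕ, 1 ≤ k → Y k ω ∈ treePoints a k) {j : ℕ} (hj : 1 ≤ j) (hjn : j ≤ n) :
    baseHeight (fun k => Y k ω) j ≤ treeHeight a Y n ω := by
  have hx : (j, (0 : ℝ)) ∈ treePoints a n := ⟨⟨hj, hjn⟩, le_rfl, (ha j hj).le⟩
  refine le_csSup ⟨totalLength a n, ?_⟩ ⟨_, hx, ?_⟩
  · rintro _ ⟨x, hx', rfl⟩
    exact (treeDist_root_mem_Icc ha hYω hx').2
  · simp only [treeDist_root_of_mem _ hx, zero_add]

lemma PotterBounds.eventually_forall_baseHeight_le (h : PotterBounds a α) (hα : 0 < α)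
    (hYω : ∀ k : ℕ, 1 ≤ k → Y k ω ∈ treePoints a k) {ε : ℝ} (hε : 0 < ε)
    (hlt : ∀ᶠ n : ℕ in atTop, pointHeight Y Y n ω < (1 + ε) * logRatio n * a n) :
    ∀ᶠ n : ℕ in atTop, ∀ j : ℕ, 1 ≤ j → j ≤ n →
      baseHeight (fun k => Y k ω) j ≤ (1 + ε) * (1 + ε) * logRatio n * a n := by
  obtain ⟨N, hN⟩ := eventually_atTop.1 ((eventually_ge_atTop 1).and (hlt.and
    (tendsto_natCast_atTop_atTop.eventually_ge_atTop (Real.exp (Real.exp 1)))))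
  filter_upwards [h.eventually_forall_le_mul hα (show 1 < 1 + ε by linarith),
    (h.tendsto_atTop hα).eventually_ge_atTop (LineBreaking.totalLength a N), eventually_ge_atTop N,
    (tendsto_logRatio_atTop.comp tendsto_natCast_atTop_atTop).eventually_ge_atTop 1]
    with n hmax hlarge hNn hratio j hj hjn
  have han := h.pos n (hN n hNn).1
  simp only [Function.comp_apply] at hratio
  rcases le_or_gt j N with hjN | hjN
  · calc baseHeight (fun k => Y k ω) j ≤ LineBreaking.totalLength a (j - 1) :=
          (baseHeight_mem_Icc h.pos hYω hj).2
      _ ≤ LineBreaking.totalLength a N := totalLength_mono h.pos (by omega)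
      _ ≤ 1 * 1 * 1 * a n := by linarith
      _ ≤ (1 + ε) * (1 + ε) * logRatio n * a n := by gcongr <;> linarith
  · obtain ⟨k, rfl⟩ : ∃ k, j = k + 1 := ⟨j - 1, by omega⟩
    obtain ⟨hk, hheight, hexp⟩ := hN k (by omega)
    have hmono : logRatio k ≤ logRatio n :=
      monotoneOn_logRatio hexp (hN n hNn).2.2 (by exact_mod_cast (show k ≤ n by omega))
    have hak := h.pos k hk
    rw [baseHeight_succ _ hk]
    calc _ ≤ (1 + ε) * logRatio k * a k := hheight.le
      _ ≤ (1 + ε) * logRatio n * ((1 + ε) * a n) := by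
        gcongr
        exact hmax k hk (by omega)
      _ = _ := by ring

lemma PotterBounds.eventually_treeHeight_le (h : PotterBounds a α) (hα : 0 < α)
    (hYω : ∀ k : ℕ, 1 ≤ k → Y k ω ∈ treePoints a k) {ε : ℝ} (hε : 0 < ε)
    (hlt : ∀ᶠ n : ℕ in atTop, pointHeight Y Y n ω < (1 + ε) * logRatio n * a n) :
    ∀ᶠ n : ℕ in atTop, treeHeight a Y n ω ≤ ((1 + ε) * (1 + ε) + ε) * logRatio n * a n := by
  filter_upwards [h.eventually_forall_baseHeight_le hα hYω hε hlt,
    h.eventually_forall_le_mul hα (show 1 < 1 + ε by linarith), eventually_ge_atTop 1,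
    (tendsto_logRatio_atTop.comp tendsto_natCast_atTop_atTop).eventually_ge_atTop ((1 + ε) / ε)]
    with n hbase hmax hn hratio
  rw [Function.comp_apply, div_le_iff₀ hε] at hratio
  refine treeHeight_le h.pos hn fun j hj hjn => ?_
  have hsegment : (1 + ε) * a n ≤ logRatio n * ε * a n :=
    mul_le_mul_of_nonneg_right hratio (h.pos n hn).le
  linarith [hbase j hj hjn, hmax j hj hjn]

end TreeHeight

section UpperBound

variable {Ω : Type*} [MeasurableSpace Ω] {P : Measure Ω} [IsProbabilityMeasure P] {a : ℕ → ℝ}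
  {α : ℝ} {Y : ℕ → Ω → ℕ × ℝ}

lemma measureReal_pointHeight_ge_le (ha : ∀ n : ℕ, 1 ≤ n → 0 < a n) (hY : IsGluingSequence P a Y)
    {n : ℕ} (hn : 1 ≤ n) {lam : ℝ} (hlam : 0 ≤ lam) (t : ℝ) :
    P.real {ω | t * a n ≤ pointHeight Y Y n ω} ≤
      Real.exp (-(lam * t)) * heightMgf a n (lam / a n) := by
  have han := ha n hn
  have hchernoff := measure_ge_le_exp_mul_mgf (μ := P) (X := pointHeight Y Y n) (t * a n)
    (t := lam / a n) (by positivity) (integrable_exp_pointHeight ha hY (hY n hn) _)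
  rwa [mgf, integral_exp_pointHeight ha hY hn (hY n hn),
    show -(lam / a n) * (t * a n) = -(lam * t) by field_simp] at hchernoff

lemma PotterBounds.eventually_heightMgf_le_rpow (h : PotterBounds a α) (hα : 0 < α) {κ c : ℝ}
    (hκ₀ : 0 < κ) (hκ₁ : κ < 1) (hc : 0 < c) :
    ∀ᶠ n : ℕ in atTop, heightMgf a n (κ * Real.log (Real.log n) / a n) ≤ (n : ℝ) ^ c := by
  obtain ⟨M, hM, hMκ⟩ := exists_between ((one_lt_div hκ₀).2 hκ₁)
  have hMκ : κ * M < 1 := by rwa [lt_div_iff₀ hκ₀, mul_comm] at hMκ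
  obtain ⟨C, hC, hmgf⟩ := h.exists_heightMgf_le hα hM
  have hlog : Tendsto (fun n : ℕ => Real.log n) atTop atTop :=
    Real.tendsto_log_atTop.comp tendsto_natCast_atTop_atTop
  filter_upwards [hmgf, eventually_ge_atTop 1, hlog.eventually_ge_atTop 1,
    hlog.eventually (eventually_log_mul_rpow_le (c := c / (C * κ)) hMκ (by positivity))]
    with n hmgf hn hlog hsmall
  have hloglog := Real.log_nonneg hlog
  refine (hmgf _ (by positivity)).trans ?_
  rw [Real.rpow_def_of_pos (by positivity), Real.exp_le_exp]
  calc C * (κ * Real.log (Real.log n)) * Real.exp (κ * Real.log (Real.log n) * M)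
      = C * κ * (Real.log (Real.log n) * Real.log n ^ (κ * M)) := by
        rw [Real.rpow_def_of_pos (by linarith), show κ * Real.log (Real.log n) * M =
          Real.log (Real.log n) * (κ * M) by ring]
        ring
    _ ≤ C * κ * (c / (C * κ) * Real.log n) := by gcongr
    _ = Real.log n * c := by field_simp

lemma PotterBounds.eventually_measureReal_pointHeight_ge_le (h : PotterBounds a α) (hα : 0 < α)
    (hY : IsGluingSequence P a Y) {ε : ℝ} (hε : 0 < ε) :
    ∀ᶠ n : ℕ in atTop, P.real {ω | (1 + ε) * logRatio n * a n ≤ pointHeight Y Y n ω} ≤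
      (n : ℝ) ^ (-(1 + ε / 4)) := by
  set κ := (1 + ε / 2) / (1 + ε) with hκ
  have hκ₁ : κ < 1 := (div_lt_one (by positivity)).2 (by linarith)
  filter_upwards [h.eventually_heightMgf_le_rpow hα (by positivity) hκ₁
    (show 0 < ε / 4 by positivity), eventually_ge_atTop 1,
    (tendsto_log_log_atTop.comp tendsto_natCast_atTop_atTop).eventually_gt_atTop 0]
    with n hmgf hn hloglog
  have hn₀ : (0 : ℝ) < n := by positivity
  simp only [Function.comp_apply] at hloglog
  have hexponent : -(κ * Real.log (Real.log n) * ((1 + ε) * logRatio n)) =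
      Real.log n * -(1 + ε / 2) := by
    rw [hκ, logRatio]
    field_simp
  calc _ ≤ Real.exp (-(κ * Real.log (Real.log n) * ((1 + ε) * logRatio n))) *
          heightMgf a n (κ * Real.log (Real.log n) / a n) :=
        measureReal_pointHeight_ge_le h.pos hY hn (by positivity) _
    _ ≤ (n : ℝ) ^ (-(1 + ε / 2)) * (n : ℝ) ^ (ε / 4) := by
        rw [hexponent, ← Real.rpow_def_of_pos hn₀]
        gcongr
    _ = (n : ℝ) ^ (-(1 + ε / 4)) := by
        rw [← Real.rpow_add hn₀]
        ring_nf

theorem PotterBounds.ae_eventually_treeHeight_le (h : PotterBounds a α) (hα : 0 < α)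
    (hY : IsGluingSequence P a Y) {r : ℝ} (hr : 1 < r) :
    ∀ᵐ ω ∂P, ∀ᶠ n : ℕ in atTop, treeHeight a Y n ω ≤ r * logRatio n * a n := by
  obtain ⟨ε, hε, hεr⟩ : ∃ ε : ℝ, 0 < ε ∧ (1 + ε) * (1 + ε) + ε ≤ r := by
    have hcont : Tendsto (fun ε : ℝ => (1 + ε) * (1 + ε) + ε) (𝓝[>] 0) (𝓝 1) :=
      ((by fun_prop : Continuous fun ε : ℝ => (1 + ε) * (1 + ε) + ε).tendsto' 0 1
        (by norm_num)).mono_left nhdsWithin_le_nhds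
    exact ((eventually_mem_nhdsWithin (s := Set.Ioi 0)).and (hcont.eventually_le_const hr)).exists
  have hsum : Summable fun n : ℕ => (n : ℝ) ^ (-(1 + ε / 4)) :=
    Real.summable_nat_rpow.2 (by linarith)
  filter_upwards [ae_eventually_notMem_of_le hsum
    (h.eventually_measureReal_pointHeight_ge_le hα hY hε), hY.ae_mem] with ω hω hYω
  have hlt : ∀ᶠ n : ℕ in atTop, pointHeight Y Y n ω < (1 + ε) * logRatio n * a n :=
    hω.mono fun n hn => not_le.1 hn
  filter_upwards [h.eventually_treeHeight_le hα hYω hε hlt, eventually_ge_atTop 1,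
    (tendsto_logRatio_atTop.comp tendsto_natCast_atTop_atTop).eventually_ge_atTop 0]
    with n hheight hn hratio
  have := h.pos n hn
  simp only [Function.comp_apply] at hratio
  exact hheight.trans (by gcongr)

end UpperBound

/-! ### Chains of segments -/

open Classical in
/-- The indices `k ∈ B` whose gluing point `g k` is in `U`. -/
noncomputable def hitIndices (B : Finset ℕ) (U : Set (ℕ × ℝ)) (g : ℕ → ℕ × ℝ) : Finset ℕ :=
  B.filter fun k => g k ∈ U

lemma mem_hitIndices {B : Finset ℕ} {U : Set (ℕ × ℝ)} {g : ℕ → ℕ × ℝ} {k : ℕ} :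
    k ∈ hitIndices B U g ↔ k ∈ B ∧ g k ∈ U := by
  classical exact Finset.mem_filter

lemma measurableSet_hitIndices_eq {U : Set (ℕ × ℝ)} (hU : MeasurableSet U) (B T : Finset ℕ) :
    MeasurableSet {g | hitIndices B U g = T} := by
  simp only [Finset.ext_iff, mem_hitIndices]
  refine measurableSet_setOfPred.2 (Measurable.forall fun k => ?_)
  have hk : Measurable fun g : ℕ → ℕ × ℝ => g k ∈ U :=
    measurableSet_setOfPred.1 ((measurable_pi_apply (X := fun _ => ℕ × ℝ) k) hU)
  exact (measurable_const.and hk).iff measurable_const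

lemma prod_exp_neg_indicator (B : Finset ℕ) (U : Set (ℕ × ℝ)) (g : ℕ → ℕ × ℝ) :
    ∏ k ∈ B, Real.exp (-U.indicator 1 (g k)) = Real.exp (-((hitIndices B U g).card : ℝ)) := by
  classical
  rw [← Real.exp_sum, Finset.sum_neg_distrib, hitIndices, Finset.card_filter]
  push_cast
  simp only [Set.indicator_apply, Pi.one_apply]

section Hits

variable {Ω : Type*} [MeasurableSpace Ω] {P : Measure Ω} {a : ℕ → ℝ} {Y : ℕ → Ω → ℕ × ℝ} {u v : ℕ}

lemma IsGluingSequence.integral_mul_prod_le (hY : IsGluingSequence P a Y)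
    {F : (ℕ → ℕ × ℝ) → ℝ} (hFm : Measurable F) (hF₀ : ∀ g, 0 ≤ F g) (hu : 1 ≤ u) (huv : u ≤ v)
    (hF : DependsOn F (Set.Ico 1 u)) {w : ℕ × ℝ → ℝ} (hwm : Measurable w) (hw₀ : ∀ x, 0 ≤ w x)
    {β : ℝ} (hβ : ∀ k ∈ Finset.Ico u v, ∫ ω, w (Y k ω) ∂P ≤ β) :
    ∫ ω, F (fun k => Y k ω) * ∏ k ∈ Finset.Ico u v, w (Y k ω) ∂P ≤
      (∫ ω, F (fun k => Y k ω) ∂P) * β ^ (v - u) := by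
  induction v, huv using Nat.le_induction with
  | base => simp
  | succ v huv ih =>
    have hv : 1 ≤ v := hu.trans huv
    set G : (ℕ → ℕ × ℝ) → ℝ := fun g => F g * ∏ k ∈ Finset.Ico u v, w (g k)
    have hGm : Measurable G := hFm.mul (Finset.measurable_prod _ fun k _ =>
      hwm.comp (measurable_pi_apply k))
    have hG : DependsOn G (Set.Ico 1 v) := by
      intro g g' hgg'
      refine congrArg₂ _ (hF.mono (Set.Ico_subset_Ico_right huv) hgg')
        (Finset.prod_congr rfl fun k hk => ?_)
      obtain ⟨huk, hkv⟩ := Finset.mem_Ico.1 hk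
      rw [hgg' k ⟨hu.trans huk, hkv⟩]
    have hindep : IndepFun (fun ω => G fun k => Y k ω) (fun ω => w (Y v ω)) P :=
      ((hY v hv).indepFun_comp hwm hGm hG).symm
    have hG₀ : ∀ g, 0 ≤ G g := fun g => mul_nonneg (hF₀ g) (Finset.prod_nonneg fun _ _ => hw₀ _)
    have ih := ih fun k hk => hβ k (Finset.Ico_subset_Ico_right v.le_succ hk)
    calc _ = ∫ ω, G (fun k => Y k ω) * w (Y v ω) ∂P := by
          simp only [G, Finset.prod_Ico_succ_top huv, mul_assoc]
      _ = (∫ ω, G (fun k => Y k ω) ∂P) * ∫ ω, w (Y v ω) ∂P :=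
          hindep.integral_fun_mul_eq_mul_integral
            (hY.measurable_comp hGm hG).aestronglyMeasurable
            (hwm.comp (hY.measurable hv)).aestronglyMeasurable
      _ ≤ (∫ ω, F (fun k => Y k ω) ∂P) * β ^ (v - u) * β :=
          mul_le_mul ih (hβ v (Finset.mem_Ico.2 ⟨huv, v.lt_succ_self⟩))
            (integral_nonneg fun _ => hw₀ _) ((integral_nonneg fun _ => hG₀ _).trans ih)
      _ = _ := by rw [Nat.succ_sub huv, pow_succ, mul_assoc]

variable [IsProbabilityMeasure P]

lemma integral_exp_neg_indicator_le {A : Set Ω} (hA : MeasurableSet A) :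
    ∫ ω, Real.exp (-A.indicator 1 ω) ∂P ≤ Real.exp (-(3 / 5 * P.real A)) := by
  have hexp : Real.exp (-1) ≤ 1 - 3 / 5 := by
    rw [Real.exp_neg, inv_le_comm₀ (Real.exp_pos 1) (by norm_num)]
    linarith [Real.exp_one_gt_d9]
  have hint : Integrable (fun ω => 3 / 5 * A.indicator (1 : Ω → ℝ) ω) P :=
    ((integrable_const 1).indicator hA).const_mul _
  calc ∫ ω, Real.exp (-A.indicator 1 ω) ∂P
      ≤ ∫ ω, (1 - 3 / 5 * A.indicator (1 : Ω → ℝ) ω) ∂P := by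
        refine integral_mono_of_nonneg (Eventually.of_forall fun _ => (Real.exp_pos _).le)
          ((integrable_const 1).sub hint) (Eventually.of_forall fun ω => ?_)
        by_cases hω : ω ∈ A
        · simpa [hω] using hexp
        · simp [hω]
    _ = -(3 / 5 * P.real A) + 1 := by
        rw [integral_sub (integrable_const 1) hint, integral_const_mul, integral_indicator_one hA]
        simp only [integral_const, probReal_univ, smul_eq_mul]
        ring
    _ ≤ _ := Real.add_one_le_exp _

lemma IsGluingSequence.integral_indicator_mul_exp_neg_card_le (hY : IsGluingSequence P a Y)
    {E : Set (ℕ → ℕ × ℝ)} (hEm : MeasurableSet E) (hu : 1 ≤ u) (huv : u ≤ v)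
    (hE : DependsOn (· ∈ E) (Set.Ico 1 u)) {U : Set (ℕ × ℝ)} (hU : MeasurableSet U)
    {p : ℝ} (hp : ∀ k ∈ Finset.Ico u v, p ≤ P.real {ω | Y k ω ∈ U}) :
    ∫ ω, E.indicator 1 (fun k => Y k ω) *
        Real.exp (-((hitIndices (Finset.Ico u v) U fun k => Y k ω).card : ℝ)) ∂P ≤
      P.real {ω | (fun k => Y k ω) ∈ E} * Real.exp (-(3 / 5 * (p * (v - u : ℕ)))) := by
  have hindicator : DependsOn (E.indicator (1 : (ℕ → ℕ × ℝ) → ℝ)) (Set.Ico 1 u) := by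
    classical
    intro g g' hgg'
    have hmem : (g ∈ E) = (g' ∈ E) := hE hgg'
    simp only [Set.indicator_apply, hmem, Pi.one_apply]
  have hβ : ∀ k ∈ Finset.Ico u v,
      ∫ ω, Real.exp (-U.indicator 1 (Y k ω)) ∂P ≤ Real.exp (-(3 / 5 * p)) := by
    intro k hk
    have hmeas := hY.measurable (hu.trans (Finset.mem_Ico.1 hk).1) hU
    refine (integral_exp_neg_indicator_le hmeas).trans (Real.exp_le_exp.2 (neg_le_neg ?_))
    exact mul_le_mul_of_nonneg_left (hp k hk) (by norm_num)
  have hprod := hY.integral_mul_prod_le (measurable_one.indicator hEm)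
    (fun g => Set.indicator_nonneg (fun _ _ => zero_le_one) g) hu huv hindicator
    (w := fun z => Real.exp (-U.indicator 1 z)) (measurable_one.indicator hU).neg.exp
    (fun _ => (Real.exp_pos _).le) hβ
  have hE_real : ∫ ω, E.indicator 1 (fun k => Y k ω) ∂P = P.real {ω | (fun k => Y k ω) ∈ E} :=
    integral_indicator_one (hY.measurable_comp (measurable_mem.2 hEm) hE).setOf
  simp only [prod_exp_neg_indicator] at hprod
  rw [hE_real, ← Real.exp_nat_mul] at hprod
  convert hprod using 3
  ring

lemma IsGluingSequence.measureReal_card_hitIndices_lt_le (hY : IsGluingSequence P a Y)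
    {E : Set (ℕ → ℕ × ℝ)} (hEm : MeasurableSet E) (hu : 1 ≤ u) (huv : u ≤ v)
    (hE : DependsOn (· ∈ E) (Set.Ico 1 u)) {U : Set (ℕ × ℝ)} (hU : MeasurableSet U)
    {p : ℝ} (hp : ∀ k ∈ Finset.Ico u v, p ≤ P.real {ω | Y k ω ∈ U}) (x : ℝ) :
    P.real {ω | (fun k => Y k ω) ∈ E ∧
        ((hitIndices (Finset.Ico u v) U fun k => Y k ω).card : ℝ) < x} ≤
      P.real {ω | (fun k => Y k ω) ∈ E} * Real.exp (x - 3 / 5 * (p * (v - u : ℕ))) := by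
  set f : Ω → ℝ := fun ω => E.indicator 1 (fun k => Y k ω) *
    Real.exp (-((hitIndices (Finset.Ico u v) U fun k => Y k ω).card : ℝ))
  have hf_mem (ω) : f ω ∈ Set.Icc 0 1 := by
    have hcard : (0 : ℝ) ≤ (hitIndices (Finset.Ico u v) U fun k => Y k ω).card := by positivity
    exact ⟨mul_nonneg (Set.indicator_nonneg (fun _ _ => zero_le_one) _) (Real.exp_pos _).le,
      mul_le_one₀ (Set.indicator_le_self' (fun _ _ => zero_le_one) _) (Real.exp_pos _).le
        (Real.exp_le_one_iff.2 (neg_nonpos.2 hcard))⟩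
  have hfm : Measurable f := by
    simp only [f, ← prod_exp_neg_indicator]
    refine Measurable.mul ?_ (Finset.measurable_prod _ fun k hk => ?_)
    · exact measurable_one.indicator (hY.measurable_comp (measurable_mem.2 hEm) hE).setOf
    · exact ((measurable_one.indicator hU).comp
        (hY.measurable (hu.trans (Finset.mem_Ico.1 hk).1))).neg.exp
  have hfi : Integrable f P := Integrable.of_bound hfm.aestronglyMeasurable 1
    (Eventually.of_forall fun ω => by
      rw [Real.norm_of_nonneg (hf_mem ω).1]; exact (hf_mem ω).2)
  have hmarkov : Real.exp (-x) * P.real {ω | Real.exp (-x) ≤ f ω} ≤ ∫ ω, f ω ∂P :=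
    mul_meas_ge_le_integral_of_nonneg (Eventually.of_forall fun ω => (hf_mem ω).1) hfi _
  calc _ ≤ P.real {ω | Real.exp (-x) ≤ f ω} := by
        refine measureReal_mono fun ω ⟨hωE, hωx⟩ => ?_
        have hf_eq : f ω = 1 * _ := congrArg (· * _) (Set.indicator_of_mem hωE _)
        rw [Set.mem_ofPred_eq, hf_eq, one_mul]
        exact Real.exp_le_exp.2 (neg_le_neg hωx.le)
    _ = Real.exp x * (Real.exp (-x) * P.real {ω | Real.exp (-x) ≤ f ω}) := by
        rw [← mul_assoc, ← Real.exp_add, add_neg_cancel, Real.exp_zero, one_mul]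
    _ ≤ _ := mul_le_mul_of_nonneg_left (hmarkov.trans
        (hY.integral_indicator_mul_exp_neg_card_le hEm hu huv hE hU hp)) (Real.exp_pos x).le
    _ = _ := by
        rw [mul_left_comm, ← Real.exp_add, ← sub_eq_add_neg]

end Hits

section UpperParts

/-- The points of the segments `b (j + 1)`, `j ∈ S`, in their upper part of relative length `δ`. The
indices are shifted because `b (j + 1)` is the segment that the gluing point `g j` positions. -/
def upperParts (a : ℕ → ℝ) (δ : ℝ) (S : Finset ℕ) : Set (ℕ × ℝ) :=
  {x | ∃ j ∈ S, x.1 = j + 1 ∧ (1 - δ) * a (j + 1) ≤ x.2}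

variable {a : ℕ → ℝ} {δ c : ℝ} {S : Finset ℕ} {j k : ℕ}

lemma measurableSet_upperParts (a : ℕ → ℝ) (δ : ℝ) (S : Finset ℕ) :
    MeasurableSet (upperParts a δ S) := by
  have hunion : upperParts a δ S =
      ⋃ j ∈ S, ({j + 1} : Set ℕ) ×ˢ Set.Ici ((1 - δ) * a (j + 1)) := by
    ext x
    simp only [upperParts, Set.mem_ofPred_eq, Set.mem_iUnion, Set.mem_prod, Set.mem_singleton_iff,
      Set.mem_Ici, exists_prop]
  rw [hunion]
  exact S.measurableSet_biUnion fun j _ => (measurableSet_singleton _).prod measurableSet_Ici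

lemma integrableOn_indicator_upperParts (a : ℕ → ℝ) (δ : ℝ) (S : Finset ℕ) (i : ℕ) :
    IntegrableOn (fun s => (upperParts a δ S).indicator (1 : ℕ × ℝ → ℝ) (i, s))
      (Set.Icc 0 (a i)) := by
  have hmeas : Measurable fun s => (upperParts a δ S).indicator (1 : ℕ × ℝ → ℝ) (i, s) :=
    (measurable_one.indicator (measurableSet_upperParts a δ S)).comp measurable_prodMk_left
  refine Integrable.of_bound hmeas.aestronglyMeasurable 1 (Eventually.of_forall fun s => ?_)
  rw [Real.norm_of_nonneg (Set.indicator_nonneg (f := 1) (fun _ _ => zero_le_one) _)]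
  exact Set.indicator_le_self' (fun _ _ => zero_le_one) _

lemma mul_le_setIntegral_indicator_upperParts (hδ₀ : 0 ≤ δ) (hδ₁ : δ ≤ 1) (hj : j ∈ S)
    (haj : 0 ≤ a (j + 1)) :
    δ * a (j + 1) ≤
      ∫ s in Set.Icc 0 (a (j + 1)), (upperParts a δ S).indicator 1 (j + 1, s) := by
  have hsub : Set.Icc ((1 - δ) * a (j + 1)) (a (j + 1)) ⊆ Set.Icc 0 (a (j + 1)) :=
    Set.Icc_subset_Icc_left (mul_nonneg (sub_nonneg.2 hδ₁) haj)
  calc δ * a (j + 1)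
      = ∫ _ in Set.Icc ((1 - δ) * a (j + 1)) (a (j + 1)), (1 : ℝ) := by
        rw [setIntegral_const, Real.volume_real_Icc_of_le (by nlinarith), smul_eq_mul]
        ring
    _ = ∫ s in Set.Icc ((1 - δ) * a (j + 1)) (a (j + 1)),
          (upperParts a δ S).indicator 1 (j + 1, s) := by
        refine setIntegral_congr_fun measurableSet_Icc fun s hs => ?_
        exact (Set.indicator_of_mem (show (j + 1, s) ∈ upperParts a δ S from
          ⟨j, hj, rfl, hs.1⟩) 1).symm
    _ ≤ _ := setIntegral_mono_set (integrableOn_indicator_upperParts a δ S _)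
        (Eventually.of_forall fun s => Set.indicator_nonneg (fun _ _ => zero_le_one) _)
        hsub.eventuallyLE

lemma IsUniformPoint.le_measureReal_upperParts {Ω : Type*} [MeasurableSpace Ω] {P : Measure Ω}
    {Y : ℕ → Ω → ℕ × ℝ} {Z : Ω → ℕ × ℝ} (ha : ∀ n : ℕ, 1 ≤ n → 0 < a n)
    (hZ : IsUniformPoint P a Y k Z) (hδ₀ : 0 ≤ δ) (hδ₁ : δ ≤ 1) (hSk : ∀ j ∈ S, j < k)
    (hc : ∀ j ∈ S, c ≤ a (j + 1)) :
    δ * c * S.card / totalLength a k ≤ P.real {ω | Z ω ∈ upperParts a δ S} := by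
  have hU := measurableSet_upperParts a δ S
  have himage : S.image (· + 1) ⊆ Finset.Icc 1 k := by
    simp only [Finset.image_subset_iff, Finset.mem_Icc]
    exact fun j hj => ⟨by omega, hSk j hj⟩
  calc δ * c * S.card / totalLength a k = (totalLength a k)⁻¹ * ∑ _ ∈ S, δ * c := by
        rw [Finset.sum_const, nsmul_eq_mul, div_eq_inv_mul, mul_comm (S.card : ℝ)]
    _ ≤ (totalLength a k)⁻¹ * ∑ j ∈ S,
          ∫ s in Set.Icc 0 (a (j + 1)), (upperParts a δ S).indicator 1 (j + 1, s) := by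
        refine mul_le_mul_of_nonneg_left (Finset.sum_le_sum fun j hj => ?_) (inv_nonneg.2 ?_)
        · exact (mul_le_mul_of_nonneg_left (hc j hj) hδ₀).trans
            (mul_le_setIntegral_indicator_upperParts hδ₀ hδ₁ hj (ha _ (by omega)).le)
        · exact Finset.sum_nonneg fun i hi => (ha i (Finset.mem_Icc.1 hi).1).le
    _ ≤ (totalLength a k)⁻¹ * ∑ i ∈ Finset.Icc 1 k,
          ∫ s in Set.Icc 0 (a i), (upperParts a δ S).indicator 1 (i, s) := by
        rw [← Finset.sum_image (f := fun i => ∫ s in Set.Icc 0 (a i),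
          (upperParts a δ S).indicator (1 : ℕ × ℝ → ℝ) (i, s)) (fun _ _ _ _ h => by simpa using h)]
        refine mul_le_mul_of_nonneg_left (Finset.sum_le_sum_of_subset_of_nonneg himage
          fun i _ _ => integral_nonneg fun s => Set.indicator_nonneg (fun _ _ => zero_le_one) _)
          (inv_nonneg.2 ?_)
        exact Finset.sum_nonneg fun i hi => (ha i (Finset.mem_Icc.1 hi).1).le
    _ = ∫ x, (upperParts a δ S).indicator 1 x ∂uniformMeasure a k :=
        (integral_uniformMeasure ha (measurable_one.indicator hU) fun i _ =>
          integrableOn_indicator_upperParts a δ S i).symm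
    _ = P.real {ω | Z ω ∈ upperParts a δ S} := by
        rw [integral_indicator_one hU, ← hZ.2.1, map_measureReal_apply hZ.1 hU]
        rfl

end UpperParts

section ChainSet

/-- The `i`-th block of `m` consecutive indices from `s` on. -/
def block (s m i : ℕ) : Finset ℕ := Finset.Ico (s + i * m) (s + (i + 1) * m)

/-- The indices `k` in the `i`-th block for which `b (k + 1)` ends a chain of `i + 1` segments, one
for each block up to the `i`-th, each glued to the upper part of the preceding one. -/
noncomputable def chainSet (a : ℕ → ℝ) (δ : ℝ) (s m : ℕ) (g : ℕ → ℕ × ℝ) : ℕ → Finset ℕ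
  | 0 => block s m 0
  | i + 1 => hitIndices (block s m (i + 1)) (upperParts a δ (chainSet a δ s m g i)) g

variable {a : ℕ → ℝ} {δ c : ℝ} {s m i k : ℕ} {g : ℕ → ℕ × ℝ}

lemma chainSet_subset_block (a : ℕ → ℝ) (δ : ℝ) (s m : ℕ) (g : ℕ → ℕ × ℝ) (i : ℕ) :
    chainSet a δ s m g i ⊆ block s m i := by
  cases i with
  | zero => exact subset_rfl
  | succ i => exact fun k hk => (mem_hitIndices.1 hk).1

lemma measurableSet_chainSet_eq (a : ℕ → ℝ) (δ : ℝ) (s m i : ℕ) (T : Finset ℕ) :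
    MeasurableSet {g | chainSet a δ s m g i = T} := by
  induction i generalizing T with
  | zero => exact MeasurableSet.const (block s m 0 = T)
  | succ i ih =>
    have hunion : {g | chainSet a δ s m g (i + 1) = T} = ⋃ S : Finset ℕ,
        {g | chainSet a δ s m g i = S} ∩
          {g | hitIndices (block s m (i + 1)) (upperParts a δ S) g = T} := by
      ext g
      simp [chainSet]
    rw [hunion]
    exact MeasurableSet.iUnion fun S =>
      (ih S).inter (measurableSet_hitIndices_eq (measurableSet_upperParts a δ S) _ T)

lemma dependsOn_chainSet (hs : 1 ≤ s) (i : ℕ) :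
    DependsOn (fun g => chainSet a δ s m g i) (Set.Ico 1 (s + (i + 1) * m)) := by
  intro g g' hgg'
  induction i with
  | zero => rfl
  | succ i ih =>
    have hprev : chainSet a δ s m g i = chainSet a δ s m g' i :=
      ih fun k hk => hgg' k ⟨hk.1, hk.2.trans_le (by gcongr; omega)⟩
    ext k
    simp only [chainSet, mem_hitIndices, hprev]
    refine and_congr_right fun hk => ?_
    obtain ⟨hsk, hk⟩ := Finset.mem_Ico.1 hk
    rw [hgg' k ⟨by omega, hk⟩]

lemma le_baseHeight_of_mem_chainSet (ha : ∀ n : ℕ, 1 ≤ n → 0 < a n)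
    (hg : ∀ k : ℕ, 1 ≤ k → g k ∈ treePoints a k) (hδ : δ ≤ 1)
    (hc : ∀ j ∈ Set.Ico s (s + (i + 1) * m), c ≤ a (j + 1)) (hk : k ∈ chainSet a δ s m g i) :
    i * ((1 - δ) * c) ≤ baseHeight g (k + 1) := by
  induction i generalizing k with
  | zero => simpa using (baseHeight_mem_Icc ha hg (show 1 ≤ k + 1 by omega)).1
  | succ i ih =>
    obtain ⟨hkB, j, hj, hgk, hupper⟩ := mem_hitIndices.1 hk
    have hend : s + (i + 1) * m ≤ s + (i + 1 + 1) * m := by gcongr; omega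
    obtain ⟨hsj, hjB⟩ := Finset.mem_Ico.1 (chainSet_subset_block a δ s m g i hj)
    have hk₁ : 1 ≤ k := by have := (Finset.mem_Ico.1 hkB).1; omega
    have hbase := ih (fun j hj => hc j (Set.Ico_subset_Ico_right hend hj)) hj
    have hpart : (1 - δ) * c ≤ (g k).2 :=
      (mul_le_mul_of_nonneg_left (hc j ⟨by omega, by omega⟩) (sub_nonneg.2 hδ)).trans hupper
    rw [baseHeight_succ g hk₁, treeDist_root_of_mem g (hg k hk₁), hgk]
    push_cast
    linarith

end ChainSet

section ChainProbability

/-- The conditions under which each block of `m` indices between `s` and `n` multiplies the number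
of chains by at least `ρ` with high probability. By the last one, a gluing point before time `n` is
in the upper part of one of `N` segments of length at least `c` with probability at least
`2 * ρ * N / m`, so that the mean number of chains in the next block is at least `2 * ρ * N`. -/
structure IsChainWindow (a : ℕ → ℝ) (δ c ρ : ℝ) (s m n : ℕ) : Prop where
  pos : ∀ n : ℕ, 1 ≤ n → 0 < a n
  part_nonneg : 0 ≤ δ
  part_le_one : δ ≤ 1
  one_le_start : 1 ≤ s
  block_pos : 0 < m
  le_length : ∀ j ∈ Set.Ico s n, c ≤ a (j + 1)
  ratio_pos : 0 < ρ
  ratio_le_one : ρ ≤ 1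
  ratio_mul_totalLength_le : 2 * ρ * totalLength a n ≤ δ * c * m

variable {Ω : Type*} [MeasurableSpace Ω] {P : Measure Ω} {a : ℕ → ℝ} {Y : ℕ → Ω → ℕ × ℝ}
  {δ c ρ t : ℝ} {s m n i : ℕ}

lemma IsChainWindow.le_measureReal_mem_upperParts (h : IsChainWindow a δ c ρ s m n)
    (hY : IsGluingSequence P a Y) {k : ℕ} (hkn : k ≤ n) {S : Finset ℕ}
    (hS : ∀ j ∈ S, j ∈ Set.Ico s k) (hsk : s ≤ k) :
    2 * ρ * S.card / m ≤ P.real {ω | Y k ω ∈ upperParts a δ S} := by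
  have hk : 1 ≤ k := h.one_le_start.trans hsk
  have := h.ratio_pos
  have := h.block_pos
  refine le_trans ?_ ((hY k hk).le_measureReal_upperParts h.pos h.part_nonneg h.part_le_one
    (fun j hj => (hS j hj).2) fun j hj => h.le_length j (Set.Ico_subset_Ico_right hkn (hS j hj)))
  rw [div_le_div_iff₀ (by positivity) (totalLength_pos h.pos hk)]
  calc 2 * ρ * S.card * totalLength a k ≤ 2 * ρ * S.card * totalLength a n :=
        mul_le_mul_of_nonneg_left (totalLength_mono h.pos hkn) (by positivity)
    _ = 2 * ρ * totalLength a n * S.card := by ring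
    _ ≤ δ * c * m * S.card :=
        mul_le_mul_of_nonneg_right h.ratio_mul_totalLength_le (Nat.cast_nonneg _)
    _ = δ * c * S.card * m := by ring

variable [IsProbabilityMeasure P]

lemma IsChainWindow.measureReal_chainSet_eq_and_card_lt_le (h : IsChainWindow a δ c ρ s m n)
    (hY : IsGluingSequence P a Y) (hin : s + (i + 2) * m ≤ n) {S : Finset ℕ}
    (hS : S ⊆ block s m i) (ht : t ≤ S.card) :
    P.real {ω | chainSet a δ s m (fun k => Y k ω) i = S ∧
        ((chainSet a δ s m (fun k => Y k ω) (i + 1)).card : ℝ) < t * ρ} ≤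
      P.real {ω | chainSet a δ s m (fun k => Y k ω) i = S} * Real.exp (-(t * ρ / 5)) := by
  have hblock {j : ℕ} (hj : j ∈ S) : s ≤ j ∧ j < s + (i + 1) * m := by
    have := Finset.mem_Ico.1 (hS hj)
    exact ⟨by omega, this.2⟩
  have hlen : s + (i + 1 + 1) * m - (s + (i + 1) * m) = m := by
    rw [Nat.add_sub_add_left, ← Nat.sub_mul, add_tsub_cancel_left, one_mul]
  have hhits := hY.measureReal_card_hitIndices_lt_le (measurableSet_chainSet_eq a δ s m i S)
    (h.one_le_start.trans (Nat.le_add_right _ _)) (show _ ≤ s + (i + 1 + 1) * m by gcongr; omega)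
    (fun g g' hgg' => congrArg (· = S) (dependsOn_chainSet h.one_le_start i hgg'))
    (measurableSet_upperParts a δ S) (p := 2 * ρ * S.card / m) (fun k hk => by
      obtain ⟨hik, hki⟩ := Finset.mem_Ico.1 hk
      exact h.le_measureReal_mem_upperParts hY (hki.le.trans hin)
        (fun j hj => ⟨(hblock hj).1, (hblock hj).2.trans_le hik⟩) (by omega)) (t * ρ)
  rw [hlen] at hhits
  calc _ = P.real {ω | chainSet a δ s m (fun k => Y k ω) i = S ∧ ((hitIndices
          (block s m (i + 1)) (upperParts a δ S) fun k => Y k ω).card : ℝ) < t * ρ} := by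
        congr 1
        ext ω
        exact and_congr_right fun hS => by rw [chainSet, hS]
    _ ≤ _ := hhits
    _ ≤ _ := by
        refine mul_le_mul_of_nonneg_left (Real.exp_le_exp.2 ?_) measureReal_nonneg
        rw [div_mul_cancel₀ _ (Nat.cast_pos.2 h.block_pos).ne']
        linarith [mul_le_mul_of_nonneg_right ht h.ratio_pos.le]

lemma IsChainWindow.measureReal_le_card_chainSet_and_card_lt_le (h : IsChainWindow a δ c ρ s m n)
    (hY : IsGluingSequence P a Y) (hin : s + (i + 2) * m ≤ n) (t : ℝ) :
    P.real {ω | t ≤ (chainSet a δ s m (fun k => Y k ω) i).card ∧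
        ((chainSet a δ s m (fun k => Y k ω) (i + 1)).card : ℝ) < t * ρ} ≤
      Real.exp (-(t * ρ / 5)) := by
  classical
  set 𝒮 := (block s m i).powerset.filter fun S => t ≤ S.card
  have hsum : ∑ S ∈ 𝒮, P.real {ω | chainSet a δ s m (fun k => Y k ω) i = S} ≤ 1 := by
    refine (sum_measureReal_preimage_singleton 𝒮 fun S _ => ?_).trans_le measureReal_le_one
    exact (hY.measurable_comp (measurable_mem.2 (measurableSet_chainSet_eq a δ s m i S))
      fun g g' hgg' => congrArg (· = S) (dependsOn_chainSet h.one_le_start i hgg')).setOf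
  calc _ ≤ P.real (⋃ S ∈ 𝒮, {ω | chainSet a δ s m (fun k => Y k ω) i = S ∧
          ((chainSet a δ s m (fun k => Y k ω) (i + 1)).card : ℝ) < t * ρ}) := by
        refine measureReal_mono (fun ω ⟨hcard, hlt⟩ => Set.mem_iUnion₂.2 ⟨_, ?_, rfl, hlt⟩)
          (measure_ne_top P _)
        exact Finset.mem_filter.2 ⟨Finset.mem_powerset.2 (chainSet_subset_block _ _ _ _ _ _), hcard⟩
    _ ≤ ∑ S ∈ 𝒮, P.real {ω | chainSet a δ s m (fun k => Y k ω) i = S ∧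
          ((chainSet a δ s m (fun k => Y k ω) (i + 1)).card : ℝ) < t * ρ} :=
        measureReal_biUnion_finset_le _ _
    _ ≤ ∑ S ∈ 𝒮, P.real {ω | chainSet a δ s m (fun k => Y k ω) i = S} *
          Real.exp (-(t * ρ / 5)) := by
        refine Finset.sum_le_sum fun S hS => ?_
        obtain ⟨hSB, htS⟩ := Finset.mem_filter.1 hS
        exact h.measureReal_chainSet_eq_and_card_lt_le hY hin
          (Finset.mem_powerset.1 hSB) htS
    _ ≤ _ := by
        rw [← Finset.sum_mul]
        exact mul_le_of_le_one_left (Real.exp_pos _).le hsum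

lemma IsChainWindow.measureReal_card_chainSet_lt_le (h : IsChainWindow a δ c ρ s m n)
    (hY : IsGluingSequence P a Y) (hin : s + (i + 1) * m ≤ n) :
    P.real {ω | ((chainSet a δ s m (fun k => Y k ω) i).card : ℝ) < m * ρ ^ i} ≤
      i * Real.exp (-(m * ρ ^ i / 5)) := by
  induction i with
  | zero => simp [chainSet, block]
  | succ i ih =>
    have hprev := ih (le_trans (by gcongr; omega) hin)
    have hstep := h.measureReal_le_card_chainSet_and_card_lt_le hY hin (m * ρ ^ i)
    rw [mul_assoc (m : ℝ), ← pow_succ] at hstep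
    have hexp : Real.exp (-(m * ρ ^ i / 5)) ≤ Real.exp (-(m * ρ ^ (i + 1) / 5)) := by
      have := pow_le_pow_of_le_one h.ratio_pos.le h.ratio_le_one i.le_succ
      gcongr
    calc _ ≤ P.real ({ω | ((chainSet a δ s m (fun k => Y k ω) i).card : ℝ) < m * ρ ^ i} ∪
          {ω | m * ρ ^ i ≤ (chainSet a δ s m (fun k => Y k ω) i).card ∧
            ((chainSet a δ s m (fun k => Y k ω) (i + 1)).card : ℝ) < m * ρ ^ (i + 1)}) :=
          measureReal_mono fun ω hω =>
            (lt_or_ge ((chainSet a δ s m (fun k => Y k ω) i).card : ℝ) (m * ρ ^ i)).imp id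
              fun hge => ⟨hge, hω⟩
      _ ≤ _ := measureReal_union_le _ _
      _ ≤ i * Real.exp (-(m * ρ ^ (i + 1) / 5)) + Real.exp (-(m * ρ ^ (i + 1) / 5)) :=
          add_le_add (hprev.trans (by gcongr)) hstep
      _ = _ := by
          push_cast
          ring

theorem IsChainWindow.measureReal_treeHeight_lt_le (h : IsChainWindow a δ c ρ s m n)
    (hY : IsGluingSequence P a Y) {L : ℕ} (hLn : s + (L + 1) * m = n) :
    P.real {ω | treeHeight a Y n ω < L * ((1 - δ) * c)} ≤ L * Real.exp (-(m * ρ ^ L / 5)) := by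
  refine le_trans (ENNReal.toReal_mono (measure_ne_top P _) (measure_mono_ae ?_))
    (h.measureReal_card_chainSet_lt_le hY hLn.le)
  filter_upwards [hY.ae_mem] with ω hYω hheight
  by_contra hcard
  have hcard_pos : 0 < (chainSet a δ s m (fun k => Y k ω) L).card := by
    have hmean : 0 < m * ρ ^ L :=
      mul_pos (Nat.cast_pos.2 h.block_pos) (pow_pos h.ratio_pos L)
    exact_mod_cast hmean.trans_le (not_lt.1 hcard)
  obtain ⟨k, hk⟩ := Finset.card_pos.1 hcard_pos
  have hkn : k < n := hLn ▸ (Finset.mem_Ico.1 (chainSet_subset_block a δ s m _ L hk)).2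
  have hbase := le_baseHeight_of_mem_chainSet h.pos hYω h.part_le_one (hLn.symm ▸ h.le_length) hk
  exact hheight.not_ge (hbase.trans (baseHeight_le_treeHeight h.pos hYω (by omega) hkn))

end ChainProbability

/-- The number of links, of length about `a n` each, of the chains that are found in `T n`, at
`x = n`: a proportion `1 - η` of the number of segments that make up the height of `T n`. -/
noncomputable def chainLength (η x : ℝ) : ℕ := ⌊(1 - η) * logRatio x⌋₊

section ChainLength

variable {η K : ℝ}

lemma mul_pow_le_rpow {x : ℝ} (hx : Real.exp (Real.exp 1) ≤ x) (hη : 0 ≤ η) (hK : 0 < K)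
    (hlogK : Real.log K ≤ η / 4 * Real.log (Real.log x)) {l : ℕ} (hl : 1 ≤ l)
    (hlx : l ≤ (1 - η / 2) * logRatio x) : (K * l) ^ l ≤ x ^ (1 - η / 4) := by
  have hx₀ : 0 < x := (Real.exp_pos _).trans_le hx
  have hlog : Real.exp 1 ≤ Real.log x := (Real.le_log_iff_exp_le hx₀).2 hx
  have hlog₀ : 0 < Real.log x := (Real.exp_pos 1).trans_le hlog
  have hloglog : 1 ≤ Real.log (Real.log x) := (Real.le_log_iff_exp_le hlog₀).2 hlog
  have hl₀ : (0 : ℝ) < l := Nat.cast_pos.2 hl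
  have hlLog : (l : ℝ) ≤ Real.log x := by
    have hratio : 0 ≤ logRatio x := by rw [logRatio]; positivity
    calc (l : ℝ) ≤ (1 - η / 2) * logRatio x := hlx
      _ ≤ logRatio x := mul_le_of_le_one_left hratio (by linarith)
      _ ≤ Real.log x := div_le_self hlog₀.le hloglog
  have hlogKl : Real.log (K * l) ≤ (1 + η / 4) * Real.log (Real.log x) := by
    rw [Real.log_mul hK.ne' hl₀.ne']
    linarith [Real.log_le_log hl₀ hlLog]
  rw [← Real.log_le_log_iff (by positivity) (by positivity), Real.log_pow, Real.log_rpow hx₀]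
  calc l * Real.log (K * l)
      ≤ l * ((1 + η / 4) * Real.log (Real.log x)) := by gcongr
    _ ≤ (1 - η / 2) * logRatio x * ((1 + η / 4) * Real.log (Real.log x)) := by gcongr
    _ = (1 - η / 2) * (1 + η / 4) * Real.log x := by rw [logRatio]; field_simp
    _ ≤ (1 - η / 4) * Real.log x :=
        mul_le_mul_of_nonneg_right (by linarith [sq_nonneg η]) hlog₀.le

lemma eventually_chainLength_add_one_le (hη₀ : 0 < η) (hη₁ : η ≤ 1) :
    ∀ᶠ x : ℝ in atTop, chainLength η x + 1 ≤ (1 - η / 2) * logRatio x := by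
  filter_upwards [tendsto_logRatio_atTop.eventually_ge_atTop (2 / η)] with x hratio
  have hratio₀ : 0 ≤ logRatio x := hratio.trans' (by positivity)
  rw [div_le_iff₀ hη₀] at hratio
  have : (chainLength η x : ℝ) ≤ (1 - η) * logRatio x :=
    Nat.floor_le (mul_nonneg (sub_nonneg.2 hη₁) hratio₀)
  linarith

lemma eventually_sq_mul_logRatio_le_chainLength (hη₀ : 0 < η) (hη₁ : η < 1) :
    ∀ᶠ x : ℝ in atTop, (1 - η) ^ 2 * logRatio x ≤ chainLength η x := by
  have hη : 0 < η * (1 - η) := mul_pos hη₀ (sub_pos.2 hη₁)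
  filter_upwards [tendsto_logRatio_atTop.eventually_ge_atTop (1 / (η * (1 - η)))] with x hratio
  rw [div_le_iff₀ hη] at hratio
  have : (1 - η) * logRatio x < chainLength η x + 1 := Nat.lt_floor_add_one _
  linarith

lemma eventually_chainLength_add_one_le_mul (hη₀ : 0 < η) (hη₁ : η ≤ 1) {δ : ℝ} (hδ : 0 < δ) :
    ∀ᶠ x : ℝ in atTop, chainLength η x + 1 ≤ δ * x := by
  filter_upwards [eventually_chainLength_add_one_le hη₀ hη₁,
    tendsto_logRatio_atTop.eventually_ge_atTop 0, tendsto_log_log_atTop.eventually_ge_atTop 1,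
    Real.tendsto_log_atTop.eventually_ge_atTop 0, eventually_ge_atTop 0,
    Real.isLittleO_log_id_atTop.bound hδ] with x hlength hratio hloglog hlog hx hlogx
  rw [id, Real.norm_of_nonneg hlog, Real.norm_of_nonneg hx] at hlogx
  calc (chainLength η x : ℝ) + 1 ≤ (1 - η / 2) * logRatio x := hlength
    _ ≤ logRatio x := mul_le_of_le_one_left hratio (by linarith)
    _ ≤ Real.log x := div_le_self hlog hloglog
    _ ≤ δ * x := hlogx

lemma eventually_rpow_le_mul_inv_pow (hη₀ : 0 < η) (hη₁ : η ≤ 1) (hK : 0 < K) :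
    ∀ᶠ x : ℝ in atTop, x ^ (η / 4) ≤
      x * (K * (chainLength η x + 1))⁻¹ ^ (chainLength η x + 1) := by
  filter_upwards [eventually_ge_atTop (Real.exp (Real.exp 1)),
    eventually_chainLength_add_one_le hη₀ hη₁,
    tendsto_log_log_atTop.eventually_ge_atTop (Real.log K / (η / 4))] with x hx hlength hlogK
  have hx₀ : 0 < x := (Real.exp_pos _).trans_le hx
  rw [div_le_iff₀' (by positivity)] at hlogK
  set L := chainLength η x
  have hpow : (K * (L + 1)) ^ (L + 1) ≤ x ^ (1 - η / 4) := by
    exact_mod_cast mul_pow_le_rpow hx hη₀.le hK hlogK L.succ_pos (by exact_mod_cast hlength)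
  calc x ^ (η / 4) = x * (x ^ (1 - η / 4))⁻¹ := by
        rw [← Real.rpow_neg hx₀.le, ← Real.rpow_one_add' hx₀.le (by linarith)]
        ring_nf
    _ ≤ x * ((K * (L + 1)) ^ (L + 1))⁻¹ := by gcongr
    _ = x * (K * (L + 1))⁻¹ ^ (L + 1) := by rw [inv_pow]

lemma eventually_mul_exp_neg_rpow_le {s : ℝ} (hs : 0 < s) :
    ∀ᶠ x : ℝ in atTop, x * Real.exp (-(x ^ s / 5)) ≤ x ^ (-2 : ℝ) := by
  filter_upwards [(isLittleO_log_rpow_atTop hs).bound (show (0 : ℝ) < 1 / 15 by norm_num),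
    eventually_gt_atTop 0] with x hlog hx
  rw [Real.norm_of_nonneg (Real.rpow_nonneg hx.le _)] at hlog
  calc x * Real.exp (-(x ^ s / 5)) ≤ x * Real.exp (Real.log x * (-3)) := by
        gcongr
        linarith [(Real.le_norm_self _).trans hlog]
    _ = x ^ (-2 : ℝ) := by
        rw [← Real.rpow_def_of_pos hx, ← Real.rpow_one_add' hx.le (by norm_num)]
        norm_num

end ChainLength

section LowerBound

variable {η δ c : ℝ} {a : ℕ → ℝ} {L n : ℕ}

lemma exists_nat_mul_le_and_le_two_mul {x y : ℝ} (hx : 0 < x) (hxy : x ≤ y) :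
    ∃ m : ℕ, x * m ≤ y ∧ y ≤ 2 * x * m := by
  have hone : 1 ≤ ⌊y / x⌋₊ := Nat.one_le_floor_iff _ |>.2 ((one_le_div hx).2 hxy)
  refine ⟨⌊y / x⌋₊, (le_div_iff₀' hx).1 (Nat.floor_le (div_nonneg (hx.le.trans hxy) hx.le)), ?_⟩
  calc y ≤ x * (⌊y / x⌋₊ + 1) := (div_le_iff₀' hx).1 (Nat.lt_floor_add_one _).le
    _ ≤ x * (⌊y / x⌋₊ + ⌊y / x⌋₊) := by gcongr; exact_mod_cast hone
    _ = 2 * x * ⌊y / x⌋₊ := by ring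

lemma exists_isChainWindow (ha : ∀ n : ℕ, 1 ≤ n → 0 < a n) (hδ₀ : 0 < δ) (hδ₁ : δ ≤ 1 / 2)
    (hL : L + 1 ≤ δ * n) (htotal : totalLength a n ≤ n * a n)
    (hmin : ∀ j : ℕ, (1 - δ) * n ≤ j → j ≤ n → c ≤ a j) (hc : a n ≤ 2 * c) :
    ∃ s m : ℕ, IsChainWindow a δ c (δ ^ 2 / (8 * (L + 1))) s m n ∧ s + (L + 1) * m = n ∧
      δ * n ≤ 2 * (L + 1) * m := by
  obtain ⟨m, hm_le, hm_ge⟩ := exists_nat_mul_le_and_le_two_mul (by positivity) hL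
  have hn : (0 : ℝ) < n := pos_of_mul_pos_right (hL.trans_lt' (by positivity)) hδ₀.le
  have hc₀ : 0 < 2 * c := (ha n (by exact_mod_cast hn)).trans_le hc
  have hmn : (L + 1) * m ≤ n := by
    exact_mod_cast hm_le.trans (mul_le_of_le_one_left hn.le (by linarith))
  have hstart : (1 - δ) * n ≤ (n - (L + 1) * m : ℕ) := by
    rw [Nat.cast_sub hmn]
    push_cast
    linarith
  refine ⟨n - (L + 1) * m, m, ?_, by omega, hm_ge⟩
  refine
    { pos := ha
      part_nonneg := hδ₀.le
      part_le_one := by linarith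
      one_le_start := ?_
      block_pos := ?_
      le_length := fun j hj => hmin (j + 1) ?_ hj.2
      ratio_pos := by positivity
      ratio_le_one := (div_le_one (by positivity)).2 (by nlinarith)
      ratio_mul_totalLength_le := ?_ }
  · have : 0 < (1 - δ) * n := mul_pos (by linarith) hn
    exact_mod_cast this.trans_le hstart
  · have : 0 < δ * n := by positivity
    exact_mod_cast pos_of_mul_pos_right (this.trans_le hm_ge) (by positivity)
  · have : ((n - (L + 1) * m : ℕ) : ℝ) ≤ j := by exact_mod_cast hj.1
    push_cast
    linarith
  · calc 2 * (δ ^ 2 / (8 * (L + 1))) * totalLength a n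
        ≤ 2 * (δ ^ 2 / (8 * (L + 1))) * (n * a n) := by gcongr
      _ = δ / (4 * (L + 1)) * a n * (δ * n) := by field_simp; ring
      _ ≤ δ / (4 * (L + 1)) * (2 * c) * (2 * (L + 1) * m) := by gcongr
      _ = δ * c * m := by field_simp; norm_num

variable {Ω : Type*} [MeasurableSpace Ω] {P : Measure Ω} [IsProbabilityMeasure P] {α : ℝ}
  {Y : ℕ → Ω → ℕ × ℝ}

lemma measureReal_treeHeight_lt_le (ha : ∀ n : ℕ, 1 ≤ n → 0 < a n) (hY : IsGluingSequence P a Y)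
    (hδ₀ : 0 < δ) (hδ₁ : δ ≤ 1 / 2) (hL : L + 1 ≤ δ * n)
    (htotal : totalLength a n ≤ n * a n)
    (hmin : ∀ j : ℕ, (1 - δ) * n ≤ j → j ≤ n → c ≤ a j) (hc : a n ≤ 2 * c) :
    P.real {ω | treeHeight a Y n ω < L * ((1 - δ) * c)} ≤
      L * Real.exp (-(n * (8 / δ ^ 2 * (L + 1))⁻¹ ^ (L + 1) / 5)) := by
  obtain ⟨s, m, hwindow, hsum, hm⟩ := exists_isChainWindow ha hδ₀ hδ₁ hL htotal hmin hc
  refine (hwindow.measureReal_treeHeight_lt_le hY hsum).trans ?_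
  have hρ : (8 / δ ^ 2 * (L + 1))⁻¹ = δ ^ 2 / (8 * (L + 1)) := by field_simp
  have hblock : n * (δ ^ 2 / (8 * (L + 1))) ≤ m := by
    calc n * (δ ^ 2 / (8 * (L + 1))) = δ * n * (δ / (8 * (L + 1))) := by ring
      _ ≤ 2 * (L + 1) * m * (δ / (8 * (L + 1))) := by gcongr
      _ = δ / 4 * m := by field_simp; ring
      _ ≤ m := mul_le_of_le_one_left (Nat.cast_nonneg m) (by linarith)
  have hmean : n * (δ ^ 2 / (8 * (L + 1))) ^ (L + 1) ≤ m * (δ ^ 2 / (8 * (L + 1))) ^ L := by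
    rw [pow_succ' _ L, ← mul_assoc]
    gcongr
  rw [hρ]
  gcongr

lemma PotterBounds.eventually_totalLength_le (h : PotterBounds a α) (hα : 0 < α) :
    ∀ᶠ n : ℕ in atTop, LineBreaking.totalLength a n ≤ n * a n := by
  filter_upwards [(h.tendsto_totalLength_div (by linarith)).eventually_le_const
    ((div_lt_one (by linarith)).2 (by linarith)), eventually_ge_atTop 1] with n hlength hn
  have := h.pos n hn
  rwa [div_le_one (by positivity)] at hlength

lemma PotterBounds.eventually_measureReal_treeHeight_lt_le (h : PotterBounds a α) (hα : 0 < α)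
    (hY : IsGluingSequence P a Y) (hη₀ : 0 < η) (hη₁ : η ≤ 1 / 2) :
    ∀ᶠ n : ℕ in atTop, P.real {ω | treeHeight a Y n ω < (1 - η) ^ 4 * logRatio n * a n} ≤
      (n : ℝ) ^ (-2 : ℝ) := by
  obtain ⟨δ₁, hδ₁, hmin⟩ := h.exists_eventually_forall_mul_le hα.le
    (show 0 < 1 - η by linarith) (show 1 - η < 1 by linarith)
  set δ := min δ₁ η
  have hδ₀ : 0 < δ := lt_min hδ₁ hη₀
  have hδη : δ ≤ η := min_le_right _ _
  have hnat := tendsto_natCast_atTop_atTop (R := ℝ)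
  filter_upwards [hmin, h.eventually_totalLength_le hα, eventually_ge_atTop 1,
    hnat.eventually (eventually_chainLength_add_one_le_mul hη₀ (by linarith) hδ₀),
    hnat.eventually (eventually_sq_mul_logRatio_le_chainLength hη₀ (by linarith)),
    hnat.eventually (eventually_rpow_le_mul_inv_pow hη₀ (by linarith)
      (show 0 < 8 / δ ^ 2 by positivity)),
    hnat.eventually (eventually_mul_exp_neg_rpow_le (show 0 < η / 4 by positivity))]
    with n hmin htotal hn hL_le hL_ge hpow hexp
  have han := h.pos n hn
  set L := chainLength η n
  have hheight : (1 - η) ^ 4 * logRatio n * a n ≤ L * ((1 - δ) * ((1 - η) * a n)) := by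
    calc (1 - η) ^ 4 * logRatio n * a n
        = (1 - η) ^ 2 * logRatio n * ((1 - η) * ((1 - η) * a n)) := by ring
      _ ≤ L * ((1 - δ) * ((1 - η) * a n)) := by gcongr <;> nlinarith
  calc _ ≤ P.real {ω | treeHeight a Y n ω < L * ((1 - δ) * ((1 - η) * a n))} :=
        measureReal_mono fun ω hω => lt_of_lt_of_le hω hheight
    _ ≤ L * Real.exp (-(n * (8 / δ ^ 2 * (L + 1))⁻¹ ^ (L + 1) / 5)) :=
        measureReal_treeHeight_lt_le h.pos hY hδ₀ (hδη.trans hη₁) hL_le htotal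
          (fun j hj hjn => hmin j (hj.trans' (by gcongr; exact min_le_left _ _)) hjn)
          (by nlinarith)
    _ ≤ n * Real.exp (-((n : ℝ) ^ (η / 4) / 5)) := by
        gcongr
        have : δ * n ≤ n := mul_le_of_le_one_left n.cast_nonneg (by linarith)
        exact_mod_cast (by linarith : (L : ℝ) ≤ n)
    _ ≤ (n : ℝ) ^ (-2 : ℝ) := hexp

theorem PotterBounds.ae_eventually_le_treeHeight (h : PotterBounds a α) (hα : 0 < α)
    (hY : IsGluingSequence P a Y) {r : ℝ} (hr₀ : 0 < r) (hr₁ : r < 1) :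
    ∀ᵐ ω ∂P, ∀ᶠ n : ℕ in atTop, r * logRatio n * a n ≤ treeHeight a Y n ω := by
  set η := (1 - r) / 4 with hη
  have hbernoulli : r ≤ (1 - η) ^ 4 := by
    have := one_add_mul_le_pow (show -2 ≤ -η by linarith) 4
    push_cast at this
    calc r = 1 + 4 * -η := by rw [hη]; ring
      _ ≤ (1 - η) ^ 4 := by rwa [sub_eq_add_neg]
  filter_upwards [ae_eventually_notMem_of_le (Real.summable_nat_rpow.2 (by norm_num))
    (h.eventually_measureReal_treeHeight_lt_le hα hY (show 0 < η by linarith) (by linarith))]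
    with ω hω
  filter_upwards [hω, eventually_ge_atTop 1,
    (tendsto_logRatio_atTop.comp tendsto_natCast_atTop_atTop).eventually_ge_atTop 0]
    with n hheight hn hratio
  have := h.pos n hn
  simp only [Function.comp_apply] at hratio
  exact le_trans (by gcongr) (not_lt.1 hheight)

theorem PotterBounds.ae_tendsto_treeHeight (h : PotterBounds a α) (hα : 0 < α)
    (hY : IsGluingSequence P a Y) :
    ∀ᵐ ω ∂P, Tendsto (fun n : ℕ => treeHeight a Y n ω * Real.log (Real.log n) /
      (a n * Real.log n)) atTop (𝓝 1) := by
  have hupper : ∀ᵐ ω ∂P, ∀ r : ℚ, 1 < r →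
      ∀ᶠ n : ℕ in atTop, treeHeight a Y n ω ≤ r * logRatio n * a n :=
    ae_all_iff.2 fun r => eventually_imp_distrib_left.2 fun hr =>
      h.ae_eventually_treeHeight_le hα hY (by exact_mod_cast hr)
  have hlower : ∀ᵐ ω ∂P, ∀ r : ℚ, 0 < r ∧ r < 1 →
      ∀ᶠ n : ℕ in atTop, r * logRatio n * a n ≤ treeHeight a Y n ω :=
    ae_all_iff.2 fun r => eventually_imp_distrib_left.2 fun hr =>
      h.ae_eventually_le_treeHeight hα hY (by exact_mod_cast hr.1) (by exact_mod_cast hr.2)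
  have hpos : ∀ᶠ n : ℕ in atTop, 0 < logRatio n * a n := by
    filter_upwards [eventually_ge_atTop 1,
      (tendsto_logRatio_atTop.comp tendsto_natCast_atTop_atTop).eventually_gt_atTop 0]
      with n hn hratio
    exact mul_pos hratio (h.pos n hn)
  have hdiv (ω : Ω) (n : ℕ) : treeHeight a Y n ω * Real.log (Real.log n) / (a n * Real.log n) =
      treeHeight a Y n ω / (logRatio n * a n) := by
    rw [logRatio, mul_comm (a n), div_mul_eq_mul_div, div_div_eq_mul_div]
  filter_upwards [hupper, hlower] with ω hω_upper hω_lower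
  simp only [hdiv]
  refine tendsto_order.2 ⟨fun b hb => ?_, fun b hb => ?_⟩
  · obtain ⟨r, hr, hr₁⟩ := exists_rat_btwn (max_lt hb one_pos)
    obtain ⟨hbr, hr₀⟩ := max_lt_iff.1 hr
    filter_upwards [hω_lower r ⟨by exact_mod_cast hr₀, by exact_mod_cast hr₁⟩, hpos] with n hn hn₀
    rw [mul_assoc] at hn
    exact hbr.trans_le ((le_div_iff₀ hn₀).2 hn)
  · obtain ⟨r, hr₁, hrb⟩ := exists_rat_btwn hb
    filter_upwards [hω_upper r (by exact_mod_cast hr₁), hpos] with n hn hn₀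
    rw [mul_assoc] at hn
    exact ((div_le_iff₀ hn₀).2 hn).trans_lt hrb

end LowerBound

end LineBreaking

theorem mainTheorem1 {Ω : Type*} [MeasurableSpace Ω] (P : Measure Ω) [IsProbabilityMeasure P]
    (a : ℕ → ℝ) (α : ℝ) (ha : ∀ n : ℕ, 1 ≤ n → 0 < a n) (hα : 0 < α)
    (hreg : LineBreaking.IsRegularlyVarying a α)
    (Y : ℕ → Ω → ℕ × ℝ) (hY : LineBreaking.IsGluingSequence P a Y) :
    (∃! ν : ProbabilityMeasure ℝ, LineBreaking.IsXiLaw α ν) ∧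
    (∀ ν : ProbabilityMeasure ℝ, LineBreaking.IsXiLaw α ν →
      ∀ X : ℕ → Ω → ℕ × ℝ, (∀ n : ℕ, 1 ≤ n → LineBreaking.IsUniformPoint P a Y n (X n)) →
        TendstoInDistribution (fun n ω => LineBreaking.pointHeight Y X n ω / a n) atTop
          (id : ℝ → ℝ) (fun _ => P) (ν : Measure ℝ) ∧
        (∀ lam : ℝ,
          (∀ n : ℕ, 1 ≤ n → Integrable
            (fun ω => Real.exp (lam * (LineBreaking.pointHeight Y X n ω / a n))) P) ∧
          Tendsto
            (fun n : ℕ => ∫ ω, Real.exp (lam * (LineBreaking.pointHeight Y X n ω / a n)) ∂P)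
            atTop (𝓝 (∫ x, Real.exp (lam * x) ∂(ν : Measure ℝ)))) ∧
        (∀ p : ℝ, 0 < p →
          (∀ n : ℕ, 1 ≤ n → Integrable
            (fun ω => (LineBreaking.pointHeight Y X n ω / a n) ^ p) P) ∧
          Integrable (fun x : ℝ => x ^ p) (ν : Measure ℝ) ∧
          Tendsto (fun n : ℕ => ∫ ω, (LineBreaking.pointHeight Y X n ω / a n) ^ p ∂P)
            atTop (𝓝 (∫ x : ℝ, x ^ p ∂(ν : Measure ℝ))))) ∧
    (∀ᵐ ω ∂P, Tendsto
      (fun n : ℕ => LineBreaking.treeHeight a Y n ω * Real.log (Real.log n) /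
        (a n * Real.log n)) atTop (𝓝 1)) := by
  have h := hreg.potterBounds ha
  refine ⟨h.existsUnique_isXiLaw hα hY, fun ν hν X hX =>
    ⟨h.tendstoInDistribution_pointHeight_div hα hY hX hν, fun lam => ⟨fun n _ => ?_, ?_⟩,
      fun p hp => ⟨fun n _ => ?_, ?_, ?_⟩⟩, h.ae_tendsto_treeHeight hα hY⟩
  · exact LineBreaking.integrable_exp_pointHeight_div ha hY hX n lam
  · rw [(hν lam).2]
    exact h.tendsto_integral_exp_pointHeight_div hα hY hX lam
  · exact LineBreaking.integrable_rpow_pointHeight_div ha hY hX n hp.le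
  · exact integrable_rpow_of_integrable_exp_mul one_ne_zero (hν 1).1 (hν (-1)).1 hp.le
  · exact h.tendsto_integral_rpow_pointHeight_div hα hY hX hν hp.le
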